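/- Let $K$ be a $p$-adic field (a non-archimedean local field of characteristic $0$) with ring of integers $\mathcal O$, uniformizer $\pi$, valuation $v$, residue field $\mathbb F_q$ and absolute value $|\xi|=q^{-v(\xi)}$ ($|0|=0$), and let $|dx|$ be the Haar measure of $K^N$ with $|dx|(\mathcal O^N)=1$. For $f=\sum_\omega c_\omega x^\omega\in\mathcal O[x_1,\dots,x_n]$ let the Newton polyhedron $\Gamma_f$ be the convex hull of $\bigcup_{c_\omega\neq0}\bigl(\omega+(\mathbb R_{\ge0})^n\bigr)$. A proper face of $\Gamma_f$ is the non-empty intersection of $\Gamma_f$ with a supporting hyperplane, a face is a proper face or $\Gamma_f$ itself, and a facet is a proper face of codimension one. Each facet has a unique primitive normal vector in $\mathbb N^n\setminus\{0\}$. For a face $\tau$ put $f_\tau=\sum_{\omega\in\tau}c_\omega x^\omega$. The polynomial $f$ is called Newton non-critical if for every face $\tau$ of $\Gamma_f$ the system $\partial f_\tau/\partial x_i=0$ $(1\le i\le n)$ has no solution in $(K^\times)^n$ (this forces $f\ne0$ and $f(0)=0$). For $a\in\mathbb N^n$ put $|a|=a_1+\dots+a_n$ and $m_f(a)=\inf_{x\in\Gamma_f}a\cdot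 x\in\mathbb N$. Let $f\in\mathcal O[x_1,\dots,x_n]$ and $g\in\mathcal O[y_1,\dots,y_m]$ be Newton non-critical, and write $(f\oplus g)(x,y)=f(x)+g(y)$. For $a\in\mathbb N^n$, $b\in\mathbb N^m$ with $c=m_f(a)>0$ and $d=m_g(b)>0$ put $$c_{a,b}(s)=-\operatorname{lcm}(c,d)\,s-\frac{c}{\gcd(c,d)}\,|b|-\frac{d}{\gcd(c,d)}\,|a| ,$$ and put $c_{a,b}(s)=-\infty$, with the convention $q^{-\infty}=0$, if $m_f(a)=0$ or $m_g(b)=0$. Let $\tau$ and $\gamma$ be proper faces of $\Gamma_f$ and $\Gamma_g$. Let $a_1,\dots,a_u$ be $\mathbb R$-linearly independent vectors among the primitive normal vectors of the facets of $\Gamma_f$ containing $\tau$, and let $b_1,\dots,b_v$ be $\mathbb R$-linearly independent vectors among the primitive normal vectors of the facets of $\Gamma_g$ containing $\gamma$. Put $\Delta_1=\bigoplus_{i=1}^u\mathbb N a_i$ and $\Delta_2=\bigoplus_{j=1}^v\mathbb N b_j$, and let $E$ be the set of all $(x,y)\in\mathcal O^n\times\mathcal O^m$ with $(v(x_1),\dots,v(x_n))\in\Delta_1$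 and $(v(y_1),\dots,v(y_m))\in\Delta_2$. Then there is a polynomial $P\in\mathbb Q[T]$ such that for all $s\in\mathbb C$ with $\operatorname{Re}(s)>0$ the function $|f(x)+g(y)|^s$ is integrable on $E$ and $$Z_{\Delta_1\times\Delta_2}(f\oplus g;s):=\int_{E}|f(x)+g(y)|^s\,|dx\,dy|=\frac{P(q^{-s})}{(1-q^{-1-s})\prod_{i=1}^u\prod_{j=1}^v\bigl(1-q^{c_{a_i,b_j}(s)}\bigr)} .$$ -/

import Mathlib

open MeasureTheory
open scoped ValuativeRel

noncomputable section

namespace ThomSebastiani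

/-! ### Newton polyhedra -/

section Newton

variable {σ : Type*} [Fintype σ]

/-- A vector of natural numbers, viewed as a real vector. -/
def realVec (a : σ → ℕ) : σ → ℝ := fun i => (a i : ℝ)

/-- `|a| = a₁ + ⋯ + aₙ`. -/
def wt (a : σ → ℕ) : ℕ := ∑ i, a i

/-- `P` is a proper face of the polyhedron `Γ`: the (nonempty) intersection of `Γ` with a
supporting hyperplane. -/
def IsProperFace (Γ P : Set (σ → ℝ)) : Prop :=
  ∃ (a : σ → ℝ) (c : ℝ), a ≠ 0 ∧ (∀ x ∈ Γ, c ≤ a ⬝ᵥ x) ∧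
    P = {x ∈ Γ | a ⬝ᵥ x = c} ∧ P.Nonempty

/-- A face is either the whole polyhedron or a proper face. -/
def IsFace (Γ P : Set (σ → ℝ)) : Prop := P = Γ ∨ IsProperFace Γ P

/-- A facet of a full-dimensional polyhedron: a proper face of codimension one. The dimension
of a face is the dimension of its affine span. -/
def IsFacet (Γ P : Set (σ → ℝ)) : Prop :=
  IsProperFace Γ P ∧ Module.finrank ℝ (vectorSpan ℝ P) + 1 = Fintype.card σ

/-- `a` is the primitive vector of `ℕⁿ ∖ {0}` perpendicular to the facet `P` of `Γ`. -/
def IsFacetNormal (Γ P : Set (σ → ℝ)) (a : σ → ℕ) : Prop :=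
  IsFacet Γ P ∧ a ≠ 0 ∧ Finset.univ.gcd a = 1 ∧
    ∀ x ∈ P, ∀ y ∈ P, realVec a ⬝ᵥ (x - y) = 0

/-- The primitive normal vectors of the facets of `Γ` that contain `τ`. -/
def facetNormals (Γ τ : Set (σ → ℝ)) : Set (σ → ℕ) :=
  {a | ∃ P, IsFacetNormal Γ P a ∧ τ ⊆ P}

/-- The submonoid `⨁ ℕ aᵢ` of `ℕⁿ`, as a set; the sum is direct when the `aᵢ` are linearly
independent. -/
def natCone {u : ℕ} (a : Fin u → σ → ℕ) : Set (σ → ℕ) :=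
  Set.range fun k : Fin u → ℕ => ∑ i, k i • a i

variable {R : Type*} [CommRing R]

/-- The Newton polyhedron of `f`: the convex hull of the union of the sets `ω + (ℝ⁺)ⁿ`, where
`ω` runs through the support of `f`. -/
def newtonPolyhedron (f : MvPolynomial σ R) : Set (σ → ℝ) :=
  convexHull ℝ {x | ∃ ω ∈ f.support, ∀ i, (ω i : ℝ) ≤ x i}

/-- The face polynomial `f_τ = ∑_{ω ∈ τ} a_ω x^ω` of `f = ∑ a_ω x^ω`. -/
def facePoly (f : MvPolynomial σ R) (τ : Set (σ → ℝ)) : MvPolynomial σ R :=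
  open Classical in
  ∑ ω ∈ f.support.filter (fun ω : σ →₀ ℕ => realVec ω ∈ τ), MvPolynomial.monomial ω (f.coeff ω)

/-- `f` is Newton non-critical over the field `K`: for each face `τ` of the Newton polyhedron
(including the polyhedron itself), `f_τ` has no critical point in `(Kˣ)ⁿ`. -/
def NewtonNonCritical (K : Type*) [Field K] [Algebra R K] (f : MvPolynomial σ R) : Prop :=
  ∀ τ, IsFace (newtonPolyhedron f) τ →
    ¬ ∃ x : σ → K, (∀ i, x i ≠ 0) ∧
      ∀ i, MvPolynomial.aeval x (MvPolynomial.pderiv i (facePoly f τ)) = 0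

/-- `m_f(a) = inf {a · x | x ∈ Γ_f}`. -/
def newtonInf (f : MvPolynomial σ R) (a : σ → ℝ) : ℝ :=
  sInf ((fun x => a ⬝ᵥ x) '' newtonPolyhedron f)

/-- `m_f(a)` for `a ∈ ℕⁿ`, as a natural number; see `natCast_newtonMin`. -/
def newtonMin (f : MvPolynomial σ R) (a : σ → ℕ) : ℕ := ⌊newtonInf f (realVec a)⌋₊

theorem newtonInf_natVec (f : MvPolynomial σ R) (h : f.support.Nonempty) (a : σ → ℕ) :
    newtonInf f (realVec a) = (f.support.inf' h fun ω => ∑ i, a i * ω i : ℕ) := by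
  set N : ℕ := f.support.inf' h fun ω => ∑ i, a i * ω i with hN
  obtain ⟨ω, hω, hωN⟩ := Finset.exists_mem_eq_inf' h fun ω : σ →₀ ℕ => ∑ i, a i * ω i
  have hlb : newtonPolyhedron f ⊆ {x | (N : ℝ) ≤ realVec a ⬝ᵥ x} := by
    refine convexHull_min ?_ ?_
    · rintro x ⟨ω', hω', hx⟩
      have h1 : N ≤ ∑ i, a i * ω' i := Finset.inf'_le _ hω'
      have h2 : (N : ℝ) ≤ ∑ i, (a i : ℝ) * (ω' i : ℝ) := by exact_mod_cast h1
      refine h2.trans (Finset.sum_le_sum fun i _ => ?_)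
      exact mul_le_mul_of_nonneg_left (hx i) (Nat.cast_nonneg _)
    · exact convex_halfSpace_ge (f := fun x : σ → ℝ => realVec a ⬝ᵥ x)
        ⟨fun x y => dotProduct_add _ _ _, fun c x => dotProduct_smul _ _ _⟩ _
  refine IsLeast.csInf_eq ⟨⟨realVec ω, subset_convexHull ℝ _ ⟨ω, hω, fun i => le_rfl⟩, ?_⟩, ?_⟩
  · simp only [dotProduct, realVec]
    rw [hN, hωN]
    push_cast
    rfl
  · rintro _ ⟨x, hx, rfl⟩
    exact hlb hx

theorem natCast_newtonMin (f : MvPolynomial σ R) (hf : f ≠ 0) (a : σ → ℕ) :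
    (newtonMin f a : ℝ) = newtonInf f (realVec a) := by
  rw [newtonMin, newtonInf_natVec f (MvPolynomial.support_nonempty.2 hf), Nat.floor_natCast]

end Newton

/-! ### The exponents `c_{a,b}(s)` -/

section Exponent

variable {σ ρ : Type*} [Fintype σ] [Fintype ρ] {R : Type*} [CommRing R]

/-- The polynomial of degree one `c_{a,b}(s) = -l s - e |b| - e' |a|`, where
`l = lcm (m_f(a), m_g(b))`, `e = m_f(a) / gcd (m_f(a), m_g(b))` and
`e' = m_g(b) / gcd (m_f(a), m_g(b))`; it is `-∞` if `m_f(a) = 0` or `m_g(b) = 0`. -/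
def cExp (f : MvPolynomial σ R) (g : MvPolynomial ρ R) (a : σ → ℕ) (b : ρ → ℕ) (s : ℂ) :
    WithBot ℂ :=
  let c := newtonMin f a
  let d := newtonMin g b
  if 0 < c ∧ 0 < d then
    ((-(Nat.lcm c d : ℂ) * s - ((c / Nat.gcd c d : ℕ) : ℂ) * (wt b : ℂ)
      - ((d / Nat.gcd c d : ℕ) : ℂ) * (wt a : ℂ) : ℂ) : WithBot ℂ)
  else ⊥

/-- `q ^ z`, with the convention `q ^ (-∞) = 0`. -/
def powBot (q : ℕ) (z : WithBot ℂ) : ℂ :=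
  WithBot.recBotCoe (C := fun _ => ℂ) 0 (fun w => (q : ℂ) ^ w) z

end Exponent

/-! ### Local zeta integrals over a compact discrete valuation ring -/

section Zeta

variable (O : Type*) [CommRing O]

/-- The cardinality `q` of the residue field. -/
def resCard [IsLocalRing O] : ℕ := Nat.card (IsLocalRing.ResidueField O)

/-- The Haar measure `|dx|` on (the Borel sets of) `Oⁿ` with total mass one, i.e. the restriction
to `Oⁿ` of the Haar measure of `Kⁿ` that gives `Oⁿ` mass one. -/
def haarO (σ : Type*) [TopologicalSpace O] [IsTopologicalRing O] [CompactSpace O] :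
    @Measure (σ → O) (borel _) :=
  letI : MeasurableSpace (σ → O) := borel _
  haveI : BorelSpace (σ → O) := ⟨rfl⟩
  Measure.addHaarMeasure ⊤

variable {O} [IsDomain O] [IsDiscreteValuationRing O]

/-- The normalized absolute value `|x| = q ^ (-v(x))` on `O`, with `|0| = 0`. -/
def absO (x : O) : ℝ :=
  open Classical in
  if x = 0 then 0 else ((resCard O : ℝ) ^ (IsDiscreteValuationRing.addVal O x).toNat)⁻¹

/-- `E_A`: the points `x` of `Oⁿ` with `(v(x₁), …, v(xₙ)) ∈ A`. -/
def shell {σ : Type*} (A : Set (σ → ℕ)) : Set (σ → O) :=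
  {x | ∃ k ∈ A, ∀ i, IsDiscreteValuationRing.addVal O (x i) = (k i : ℕ∞)}

/-- The integrand `|f(x)| ^ s`. -/
def zetaIntegrand {σ : Type*} (f : MvPolynomial σ O) (s : ℂ) (x : σ → O) : ℂ :=
  ((absO (MvPolynomial.eval x f) : ℝ) : ℂ) ^ s

/-- `Z_A(f; s) = ∫_{E_A} |f(x)| ^ s |dx|`. -/
def zetaOn [TopologicalSpace O] [IsTopologicalRing O] [CompactSpace O] {σ : Type*}
    (A : Set (σ → ℕ)) (f : MvPolynomial σ O) (s : ℂ) : ℂ :=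
  ∫ x in shell A, zetaIntegrand f s x ∂(haarO O σ)

end Zeta

/-- `f ⊕ g = f(x) + g(y)` in separated variables. -/
def polySum {σ ρ R : Type*} [CommRing R] (f : MvPolynomial σ R) (g : MvPolynomial ρ R) :
    MvPolynomial (σ ⊕ ρ) R :=
  MvPolynomial.rename Sum.inl f + MvPolynomial.rename Sum.inr g

/-- The product `A × B` of `A ⊆ ℕⁿ` and `B ⊆ ℕᵐ`, as a set of vectors indexed by the disjoint
union of the two sets of variables. -/
def prodSet {σ ρ : Type*} (A : Set (σ → ℕ)) (B : Set (ρ → ℕ)) : Set (σ ⊕ ρ → ℕ) :=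
  {k | k ∘ Sum.inl ∈ A ∧ k ∘ Sum.inr ∈ B}

end ThomSebastiani

end

open ThomSebastiani

set_option linter.unusedSectionVars false

noncomputable section

namespace ThomSebastiani

section Algebra

variable {ι R : Type*} [CommRing R]

theorem exists_eval_add_single_eq [DecidableEq ι] (p : MvPolynomial ι R) (i : ι) (z : ι → R)
    (ε : R) :
    ∃ k, MvPolynomial.eval (z + Pi.single i ε) p =
      MvPolynomial.eval z p + ε * MvPolynomial.eval z (MvPolynomial.pderiv i p) + ε ^ 2 * k := by
  induction p using MvPolynomial.induction_on with
  | C a => exact ⟨0, by simp⟩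
  | add p q hp hq =>
    obtain ⟨k, hk⟩ := hp
    obtain ⟨l, hl⟩ := hq
    exact ⟨k + l, by simp only [map_add, hk, hl]; ring⟩
  | mul_X p j hp =>
    obtain ⟨k, hk⟩ := hp
    by_cases h : j = i
    · subst h
      refine ⟨k * (z j + ε) + MvPolynomial.eval z (MvPolynomial.pderiv j p), ?_⟩
      simp [hk, Derivation.leibniz]
      ring
    · refine ⟨k * z j, ?_⟩
      simp [hk, Derivation.leibniz, MvPolynomial.pderiv_X_of_ne h, Pi.single_eq_of_ne h]
      ring

theorem dvd_eval_sub_eval (p : MvPolynomial ι R) {c : R} {z z' : ι → R}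
    (h : ∀ i, c ∣ z i - z' i) : c ∣ MvPolynomial.eval z p - MvPolynomial.eval z' p := by
  induction p using MvPolynomial.induction_on with
  | C a => simp
  | add p q hp hq =>
    simp only [map_add]
    rw [add_sub_add_comm]
    exact dvd_add hp hq
  | mul_X p j hp =>
    simp only [map_mul, MvPolynomial.eval_X]
    have : MvPolynomial.eval z p * z j - MvPolynomial.eval z' p * z' j =
        (MvPolynomial.eval z p - MvPolynomial.eval z' p) * z j +
          MvPolynomial.eval z' p * (z j - z' j) := by ring
    rw [this]
    exact dvd_add (dvd_mul_of_dvd_left hp _) (dvd_mul_of_dvd_right (h j) _)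

end Algebra

section Uniformizer

variable {O : Type*} [CommRing O] [IsDomain O] [IsDiscreteValuationRing O] {ϖ : O}

theorem isUnit_iff_not_dvd (hϖ : Irreducible ϖ) (x : O) : IsUnit x ↔ ¬ ϖ ∣ x := by
  rw [← not_iff_not, not_not, ← Ideal.mem_span_singleton,
    ← (IsDiscreteValuationRing.irreducible_iff_uniformizer ϖ).1 hϖ, IsLocalRing.mem_maximalIdeal,
    mem_nonunits_iff]

theorem residue_eq_zero_iff_dvd (hϖ : Irreducible ϖ) (x : O) :
    IsLocalRing.residue O x = 0 ↔ ϖ ∣ x := by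
  rw [IsLocalRing.residue_eq_zero_iff, IsLocalRing.mem_maximalIdeal, mem_nonunits_iff,
    isUnit_iff_not_dvd hϖ, not_not]

end Uniformizer

section Topology

variable {O : Type*} [CommRing O] [IsDomain O] [IsDiscreteValuationRing O] [TopologicalSpace O]
  [IsTopologicalRing O] [CompactSpace O] [T2Space O] {ϖ : O}

theorem isOpen_setOf_pow_dvd (hϖ : Irreducible ϖ) (n : ℕ) : IsOpen {x : O | ϖ ^ n ∣ x} := by
  have h := (IsDiscreteValuationRing.isOpen_iff (R := O) (I := Ideal.span {ϖ ^ n})).2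
    (by simp [hϖ.ne_zero])
  convert h using 1
  ext x
  exact Ideal.mem_span_singleton.symm

theorem isOpen_setOf_pow_dvd_comp (hϖ : Irreducible ϖ) {X : Type*} [TopologicalSpace X]
    {f : X → O} (hf : Continuous f) (n : ℕ) : IsOpen {x | ϖ ^ n ∣ f x} :=
  (isOpen_setOf_pow_dvd hϖ n).preimage hf

theorem isClosed_setOf_pow_dvd (n : ℕ) : IsClosed {x : O | ϖ ^ n ∣ x} := by
  have h := IsNoetherianRing.isClosed_ideal (Ideal.span {ϖ ^ n})
  convert h using 1
  ext x
  exact Ideal.mem_span_singleton.symm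

theorem finite_quotient_span_pow (hϖ : Irreducible ϖ) (n : ℕ) :
    Finite (O ⧸ Ideal.span {ϖ ^ n}) :=
  IsLocalRing.isOpen_iff_finite_quotient.1
    ((IsDiscreteValuationRing.isOpen_iff (R := O)).2 (by simp [hϖ.ne_zero]))

/-- The points of `Oⁿ` all of whose coordinates are units. -/
def unitPts (O ι : Type*) [CommRing O] : Set (ι → O) := {z | ∀ i, IsUnit (z i)}

/-- The points where `h` is divisible by `c`. -/
def dvdSet {O ι : Type*} [CommRing O] (h : MvPolynomial ι O) (c : O) : Set (ι → O) :=
  {z | c ∣ MvPolynomial.eval z h}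

variable {ι : Type*} [Finite ι]

theorem isOpen_dvdSet (hϖ : Irreducible ϖ) (h : MvPolynomial ι O) (n : ℕ) :
    IsOpen (dvdSet h (ϖ ^ n)) :=
  isOpen_setOf_pow_dvd_comp hϖ h.continuous_eval n

theorem isClosed_isUnit (hϖ : Irreducible ϖ) : IsClosed {x : O | IsUnit x} := by
  simp only [isUnit_iff_not_dvd hϖ]
  have h := (isOpen_setOf_pow_dvd hϖ 1).isClosed_compl
  rwa [pow_one] at h

theorem isOpen_unitPts (hϖ : Irreducible ϖ) : IsOpen (unitPts O ι) := by
  have : unitPts O ι = ⋂ i, {z | IsUnit (z i)} := by ext; simp [unitPts]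
  rw [this]
  refine isOpen_iInter_of_finite fun i => ?_
  simp only [isUnit_iff_not_dvd hϖ]
  have h := (isClosed_setOf_pow_dvd (ϖ := ϖ) 1).isOpen_compl.preimage
    (continuous_apply (A := fun _ : ι => O) i)
  rwa [pow_one] at h

theorem isCompact_unitPts (hϖ : Irreducible ϖ) : IsCompact (unitPts O ι) := by
  have : unitPts O ι = ⋂ i, {z | IsUnit (z i)} := by ext; simp [unitPts]
  rw [this]
  exact (isClosed_iInter fun i => (isClosed_isUnit hϖ).preimage (continuous_apply i)).isCompact

end Topology

section Measure

variable {O : Type*} [CommRing O] [IsDomain O] [IsDiscreteValuationRing O] [TopologicalSpace O]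
  [IsTopologicalRing O] [CompactSpace O] [T2Space O] {ϖ : O} {ι : Type*} [Finite ι]
  [MeasurableSpace (ι → O)] [BorelSpace (ι → O)] (μ : Measure (ι → O))

theorem measure_eq_sum_mod (hϖ : Irreducible ϖ) (n : ℕ) {S : Set (ι → O)}
    (hS : MeasurableSet S) [Fintype (ι → O ⧸ Ideal.span {ϖ ^ n})] :
    μ S = ∑ c : ι → O ⧸ Ideal.span {ϖ ^ n},
      μ (S ∩ {z | ∀ i, Ideal.Quotient.mk _ (z i) = c i}) := by
  have hm (c : ι → O ⧸ Ideal.span {ϖ ^ n}) :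
      MeasurableSet {z : ι → O | ∀ i, Ideal.Quotient.mk _ (z i) = c i} := by
    refine IsOpen.measurableSet ?_
    simp only [Set.ofPred_forall]
    refine isOpen_iInter_of_finite fun i => ?_
    obtain ⟨y, hy⟩ := Ideal.Quotient.mk_surjective (c i)
    have := isOpen_setOf_pow_dvd_comp hϖ
      (f := fun z : ι → O => z i - y) (by fun_prop) n
    simpa [← hy, Ideal.Quotient.eq, Ideal.mem_span_singleton] using this
  have hd : Pairwise (Function.onFun Disjoint fun c : ι → O ⧸ Ideal.span {ϖ ^ n} =>
      {z : ι → O | ∀ i, Ideal.Quotient.mk _ (z i) = c i}) := by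
    intro c c' hcc
    refine Set.disjoint_left.2 fun z hz hz' => hcc (funext fun i => (hz i).symm.trans (hz' i))
  have hU : (⋃ c : ι → O ⧸ Ideal.span {ϖ ^ n},
      {z : ι → O | ∀ i, Ideal.Quotient.mk _ (z i) = c i}) = Set.univ :=
    Set.eq_univ_of_forall fun z => Set.mem_iUnion.2 ⟨fun i => Ideal.Quotient.mk _ (z i), fun i => rfl⟩
  rw [← tsum_fintype (L := .unconditional _), ← measure_iUnion, ← Set.inter_iUnion, hU,
    Set.inter_univ]
  · exact fun c c' hcc => (hd hcc).mono Set.inter_subset_right Set.inter_subset_right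
  · exact fun c => hS.inter (hm c)

variable [μ.IsAddLeftInvariant]

theorem measure_inter_dvdSet_of_class (hϖ : Irreducible ϖ) (h : MvPolynomial ι O) {e L r : ℕ}
    (hL : 2 * e + 1 ≤ L) (hr : r ≤ e) (i : ι) {w : O} (hw : IsUnit w) {S : Set (ι → O)}
    (hS : MeasurableSet S) (hinv : ∀ v z, (∀ j, ϖ ^ (e + 1) ∣ v j) → (v + z ∈ S ↔ z ∈ S))
    (hder : ∀ z ∈ S, ϖ ^ (r + 1) ∣ MvPolynomial.eval z (MvPolynomial.pderiv i h) - ϖ ^ r * w) :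
    μ (S ∩ dvdSet h (ϖ ^ L)) = resCard O * μ (S ∩ dvdSet h (ϖ ^ (L + 1))) := by
  classical
  have : Fintype (IsLocalRing.ResidueField O) := Fintype.ofFinite _
  let F (ρ : IsLocalRing.ResidueField O) : Set (ι → O) :=
    S ∩ {z | ∃ y, MvPolynomial.eval z h = ϖ ^ L * y ∧ IsLocalRing.residue O y = ρ}
  have hF0 : F 0 = S ∩ dvdSet h (ϖ ^ (L + 1)) := by
    ext z
    simp only [F, Set.mem_inter_iff, Set.mem_ofPred_eq, residue_eq_zero_iff_dvd hϖ, dvdSet]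
    refine and_congr_right fun _ => ⟨?_, ?_⟩
    · rintro ⟨_, h1, y, rfl⟩
      exact ⟨y, by rw [h1]; ring⟩
    · rintro ⟨y, hy⟩
      exact ⟨ϖ * y, by rw [hy]; ring, y, rfl⟩
  have hUn : S ∩ dvdSet h (ϖ ^ L) = ⋃ ρ, F ρ := by
    ext z
    simp only [F, Set.mem_inter_iff, Set.mem_ofPred_eq, dvdSet, Set.mem_iUnion]
    constructor
    · rintro ⟨hz, y, hy⟩
      exact ⟨_, hz, y, hy, rfl⟩
    · rintro ⟨_, hz, y, hy, -⟩
      exact ⟨hz, y, hy⟩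
  have hdisj : Pairwise (Function.onFun Disjoint F) := by
    intro ρ ρ' hne
    refine Set.disjoint_left.2 ?_
    rintro z ⟨-, y, hy, rfl⟩ ⟨-, y', hy', rfl⟩
    exact hne (by rw [mul_left_cancel₀ (pow_ne_zero L hϖ.ne_zero) (hy.symm.trans hy')])
  have htrans (ρ) : ∃ v : ι → O, (v + ·) ⁻¹' F ρ = F 0 := by
    obtain ⟨t, ht⟩ := IsLocalRing.residue_surjective (R := O) (ρ / IsLocalRing.residue O w)
    have hw' : IsLocalRing.residue O w ≠ 0 := by
      rwa [Ne, residue_eq_zero_iff_dvd hϖ, ← isUnit_iff_not_dvd hϖ]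
    have htw : IsLocalRing.residue O (t * w) = ρ := by
      rw [map_mul, ht, div_mul_cancel₀ _ hw']
    refine ⟨Pi.single i (ϖ ^ (L - r) * t), ?_⟩
    ext z
    simp only [F, Set.mem_preimage, Set.mem_inter_iff, Set.mem_ofPred_eq]
    rw [hinv]
    swap
    · intro j
      by_cases hj : j = i
      · subst hj
        rw [Pi.single_eq_same]
        exact dvd_mul_of_dvd_left (pow_dvd_pow _ (by omega)) _
      · simp [Pi.single_eq_of_ne hj]
    refine and_congr_right fun hz => ?_
    obtain ⟨d, hd⟩ := hder z hz
    rw [sub_eq_iff_eq_add] at hd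
    obtain ⟨k, hk⟩ := exists_eval_add_single_eq h i z (ϖ ^ (L - r) * t)
    have key : ∃ x, MvPolynomial.eval (Pi.single i (ϖ ^ (L - r) * t) + z) h =
        MvPolynomial.eval z h + ϖ ^ L * (t * w + ϖ * x) := by
      refine ⟨t * d + ϖ ^ (L - r - r - 1) * t ^ 2 * k, ?_⟩
      rw [add_comm (Pi.single _ _), hk, hd]
      obtain ⟨m, rfl⟩ : ∃ m, L = 2 * r + 1 + m := ⟨L - (2 * r + 1), by omega⟩
      have e1 : 2 * r + 1 + m - r = r + 1 + m := by omega
      have e2 : r + 1 + m - r - 1 = m := by omega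
      rw [e1, e2]
      ring
    obtain ⟨x, hx⟩ := key
    have hres : IsLocalRing.residue O (ϖ * x) = 0 := by
      rw [residue_eq_zero_iff_dvd hϖ]; exact dvd_mul_right _ _
    rw [hx]
    constructor
    · rintro ⟨y, hy, hy'⟩
      refine ⟨y - (t * w + ϖ * x), by rw [mul_sub, ← hy]; ring, ?_⟩
      rw [map_sub, map_add, hres, htw, hy']
      ring
    · rintro ⟨y, hy, hy'⟩
      refine ⟨y + (t * w + ϖ * x), by rw [hy]; ring, ?_⟩
      rw [map_add, map_add, hres, htw, hy']
      ring
  have hmeas0 : MeasurableSet (F 0) := by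
    rw [hF0]; exact hS.inter (isOpen_dvdSet hϖ h _).measurableSet
  have hmeas (ρ) : MeasurableSet (F ρ) := by
    obtain ⟨v, hv⟩ := htrans ρ
    have : F ρ = (-v + ·) ⁻¹' F 0 := by
      rw [← hv]; ext z; simp
    rw [this]
    exact measurable_const_add (-v) hmeas0
  have hμ (ρ) : μ (F ρ) = μ (F 0) := by
    obtain ⟨v, hv⟩ := htrans ρ
    rw [← hv, measure_preimage_add]
  rw [hUn, measure_iUnion hdisj hmeas, tsum_fintype]
  simp [hμ, hF0, resCard, Nat.card_eq_fintype_card]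

/-- Hensel's lemma, in the form of a count of the solutions of `h ≡ 0`. -/
theorem measure_unitPts_inter_dvdSet_eq (hϖ : Irreducible ϖ) (h : MvPolynomial ι O) {e L : ℕ}
    (hL : 2 * e + 1 ≤ L)
    (hder : ∀ z ∈ unitPts O ι, ∃ i, ¬ ϖ ^ (e + 1) ∣ MvPolynomial.eval z (MvPolynomial.pderiv i h)) :
    μ (unitPts O ι ∩ dvdSet h (ϖ ^ L)) =
      resCard O * μ (unitPts O ι ∩ dvdSet h (ϖ ^ (L + 1))) := by
  classical
  have := finite_quotient_span_pow hϖ (e + 1)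
  have : Fintype (ι → O ⧸ Ideal.span {ϖ ^ (e + 1)}) := Fintype.ofFinite _
  have hU := (isOpen_unitPts (ι := ι) hϖ).measurableSet
  rw [measure_eq_sum_mod μ hϖ (e + 1) (hU.inter (isOpen_dvdSet hϖ h L).measurableSet),
    measure_eq_sum_mod μ hϖ (e + 1) (hU.inter (isOpen_dvdSet hϖ h (L + 1)).measurableSet),
    Finset.mul_sum]
  refine Finset.sum_congr rfl fun c _ => ?_
  rw [Set.inter_right_comm, Set.inter_right_comm _ _ {z | _}]
  set S : Set (ι → O) := unitPts O ι ∩ {z | ∀ i, Ideal.Quotient.mk _ (z i) = c i} with hS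
  rcases S.eq_empty_or_nonempty with h0 | ⟨z0, hz0⟩
  · simp [h0]
  have hmem (z : ι → O) : z ∈ S ↔ ∀ j, ϖ ^ (e + 1) ∣ z j - z0 j := by
    have h1 (j) : Ideal.Quotient.mk (Ideal.span {ϖ ^ (e + 1)}) (z j) = c j ↔
        ϖ ^ (e + 1) ∣ z j - z0 j := by
      rw [← hz0.2 j, Ideal.Quotient.eq, Ideal.mem_span_singleton]
    refine ⟨fun hz j => (h1 j).1 (hz.2 j), fun hz => ⟨fun j => ?_, fun j => (h1 j).2 (hz j)⟩⟩
    have h2 := hz0.1 j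
    rw [isUnit_iff_not_dvd hϖ] at h2 ⊢
    have h3 : ϖ ∣ z j - z0 j := (dvd_pow_self ϖ (Nat.succ_ne_zero e)).trans (hz j)
    exact fun h4 => h2 ((dvd_sub_right h4).1 h3)
  obtain ⟨i, hi⟩ := hder z0 hz0.1
  obtain ⟨r, hr, w, hw, hrw⟩ : ∃ r ≤ e, ∃ w, IsUnit w ∧
      MvPolynomial.eval z0 (MvPolynomial.pderiv i h) = ϖ ^ r * w := by
    obtain ⟨r, u, hu⟩ := IsDiscreteValuationRing.eq_unit_mul_pow_irreducible
      (x := MvPolynomial.eval z0 (MvPolynomial.pderiv i h)) (fun h0 => hi (by simp [h0])) hϖ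
    refine ⟨r, ?_, u, u.isUnit, by rw [hu]; ring⟩
    by_contra hlt
    exact hi (hu ▸ dvd_mul_of_dvd_right (pow_dvd_pow _ (by omega)) _)
  refine measure_inter_dvdSet_of_class μ hϖ h hL hr i hw ?_ ?_ ?_
  · have : S = ⋂ j, {z | ϖ ^ (e + 1) ∣ z j - z0 j} := by ext z; simp [hmem]
    rw [this]
    refine (isOpen_iInter_of_finite fun j => ?_).measurableSet
    exact isOpen_setOf_pow_dvd_comp hϖ (by fun_prop) _
  · intro v z hv
    simp only [hmem]
    refine forall_congr' fun j => ?_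
    rw [Pi.add_apply, add_sub_assoc, dvd_add_right (hv j)]
  · intro z hz
    rw [← hrw]
    exact (pow_dvd_pow _ (by omega)).trans (dvd_eval_sub_eval _ ((hmem z).1 hz))

end Measure

section AbsoluteValue

variable {O : Type*} [CommRing O] [IsDomain O] [IsDiscreteValuationRing O]

theorem pow_dvd_iff_le_addVal {ϖ : O} (hϖ : Irreducible ϖ) (n : ℕ) (x : O) :
    ϖ ^ n ∣ x ↔ (n : ℕ∞) ≤ IsDiscreteValuationRing.addVal O x := by
  rw [← hϖ.addVal_pow, IsDiscreteValuationRing.addVal_le_iff_dvd]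

theorem addVal_eq_iff_dvd {ϖ : O} (hϖ : Irreducible ϖ) (n : ℕ) (x : O) :
    IsDiscreteValuationRing.addVal O x = n ↔ ϖ ^ n ∣ x ∧ ¬ ϖ ^ (n + 1) ∣ x := by
  rw [pow_dvd_iff_le_addVal hϖ, pow_dvd_iff_le_addVal hϖ, Nat.cast_add, Nat.cast_one,
    ENat.add_one_le_iff (ENat.natCast_ne_top n), not_lt, le_antisymm_iff, and_comm]

theorem absO_zero_cpow {s : ℂ} (hs : s ≠ 0) : ((absO (0 : O) : ℝ) : ℂ) ^ s = 0 := by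
  simp [absO, hs]

theorem absO_cpow {x : O} {n : ℕ} (hx : IsDiscreteValuationRing.addVal O x = n) (s : ℂ) :
    ((absO x : ℝ) : ℂ) ^ s = ((resCard O : ℂ) ^ (-s)) ^ n := by
  have h0 : x ≠ 0 := by
    rintro rfl
    simp at hx
  simp only [absO, h0, if_false, hx, ENat.toNat_natCast]
  have h1 : ∀ n : ℕ, (((resCard O) ^ n : ℕ) : ℂ) ^ s = ((resCard O : ℂ) ^ s) ^ n := by
    intro n
    induction n with
    | zero => simp
    | succ n ih =>
      rw [pow_succ, pow_succ, ← ih, Nat.cast_mul, Complex.natCast_mul_natCast_cpow]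
  have h2 : ((((resCard O : ℝ) ^ n)⁻¹ : ℝ) : ℂ) = (((resCard O) ^ n : ℕ) : ℂ)⁻¹ := by push_cast; rfl
  rw [h2, Complex.inv_cpow _ _ (by rw [Complex.natCast_arg]; exact Real.pi_pos.ne), h1,
    Complex.cpow_neg, inv_pow]

variable [Finite (IsLocalRing.ResidueField O)]

theorem one_lt_resCard : 1 < resCard O := Finite.one_lt_card

theorem norm_resCard_cpow_neg_lt_one {s : ℂ} (hs : 0 < s.re) :
    ‖(resCard O : ℂ) ^ (-s)‖ < 1 := by
  have h1 := one_lt_resCard (O := O)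
  rw [Complex.norm_natCast_cpow_of_pos (by omega)]
  exact Real.rpow_lt_one_of_one_lt_of_neg (by exact_mod_cast h1) (by simpa using hs)

end AbsoluteValue

section Rational

variable {O : Type*} [CommRing O] [IsDomain O] [IsDiscreteValuationRing O] [TopologicalSpace O]
  [IsTopologicalRing O] [CompactSpace O] [T2Space O] {ϖ : O} {ι : Type*} [Finite ι]
  [MeasurableSpace (ι → O)] [BorelSpace (ι → O)] (μ : Measure (ι → O))
  [μ.IsAddLeftInvariant] [IsProbabilityMeasure μ]

/-- A set that is a union of residue classes has rational measure. -/
theorem exists_rat_measureReal_eq (hϖ : Irreducible ϖ) (n : ℕ) {S : Set (ι → O)}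
    (hS : MeasurableSet S) (hinv : ∀ v z, (∀ j, ϖ ^ n ∣ v j) → z ∈ S → v + z ∈ S) :
    ∃ r : ℚ, μ.real S = r := by
  classical
  have := finite_quotient_span_pow hϖ n
  have : Fintype (ι → O ⧸ Ideal.span {ϖ ^ n}) := Fintype.ofFinite _
  let C (c : ι → O ⧸ Ideal.span {ϖ ^ n}) : Set (ι → O) := {z | ∀ i, Ideal.Quotient.mk _ (z i) = c i}
  have hC (c) : μ (C c) = μ (C 0) := by
    choose y hy using fun i => Ideal.Quotient.mk_surjective (c i)
    have : C 0 = (y + ·) ⁻¹' C c := by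
      ext z
      simp [C, hy]
    rw [this, measure_preimage_add]
  have h1 : (1 : ENNReal) = Fintype.card (ι → O ⧸ Ideal.span {ϖ ^ n}) * μ (C 0) := by
    rw [← measure_univ (μ := μ), measure_eq_sum_mod μ hϖ n MeasurableSet.univ]
    simp only [Set.univ_inter]
    rw [Finset.sum_congr rfl fun c _ => hC c]
    simp
  let A := Finset.univ.filter fun c => (S ∩ C c).Nonempty
  have h2 : μ S = A.card * μ (C 0) := by
    have h3 (c) : μ (S ∩ C c) = if (S ∩ C c).Nonempty then μ (C 0) else 0 := by
      split_ifs with h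
      · obtain ⟨z0, hz0, hc0⟩ := h
        rw [← hC c]
        congr 1
        refine Set.inter_eq_right.2 fun z hz => ?_
        rw [← sub_add_cancel z z0]
        refine hinv _ _ (fun j => ?_) hz0
        rw [Pi.sub_apply, ← Ideal.mem_span_singleton, ← Ideal.Quotient.eq, hz j, hc0 j]
      · rw [Set.not_nonempty_iff_eq_empty.1 h, measure_empty]
    rw [measure_eq_sum_mod μ hϖ n hS, Finset.sum_congr rfl fun c _ => h3 c, ← Finset.sum_filter]
    simp [A]
  refine ⟨A.card / Fintype.card (ι → O ⧸ Ideal.span {ϖ ^ n}), ?_⟩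
  have h1' := congrArg ENNReal.toReal h1
  have h2' := congrArg ENNReal.toReal h2
  simp only [ENNReal.toReal_mul, ENNReal.toReal_natCast, ENNReal.toReal_one] at h1' h2'
  rw [measureReal_def, h2']
  have h4 : (Fintype.card (ι → O ⧸ Ideal.span {ϖ ^ n}) : ℝ) ≠ 0 := by
    intro h; simp [h] at h1'
  push_cast
  field_simp
  linear_combination (A.card : ℝ) * (-h1')

theorem exists_rat_measureReal_unitPts_inter_dvdSet (hϖ : Irreducible ϖ) (h : MvPolynomial ι O)
    (n : ℕ) : ∃ r : ℚ, μ.real (unitPts O ι ∩ dvdSet h (ϖ ^ n)) = r := by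
  refine exists_rat_measureReal_eq μ hϖ (n + 1) ((isOpen_unitPts hϖ).measurableSet.inter
    (isOpen_dvdSet hϖ h n).measurableSet) ?_
  rintro v z hv ⟨hz, hz'⟩
  refine ⟨fun i => ?_, ?_⟩
  · have := hz i
    rw [isUnit_iff_not_dvd hϖ] at this ⊢
    rwa [Pi.add_apply, dvd_add_right ((dvd_pow_self ϖ (Nat.succ_ne_zero n)).trans (hv i))]
  · have h1 : ϖ ^ n ∣ MvPolynomial.eval (v + z) h - MvPolynomial.eval z h :=
      dvd_eval_sub_eval h fun i => by
        simpa using (pow_dvd_pow ϖ (Nat.le_succ n)).trans (hv i)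
    exact (dvd_sub_left hz').1 h1

end Rational

section Integrand

variable {O : Type*} [CommRing O] [IsDomain O] [IsDiscreteValuationRing O] [TopologicalSpace O]
  [IsTopologicalRing O] [CompactSpace O] [T2Space O] {ϖ : O} {ι : Type*} [Finite ι]
  [MeasurableSpace (ι → O)] [BorelSpace (ι → O)]

theorem measurable_addVal_eval (h : MvPolynomial ι O) :
    Measurable fun z : ι → O => IsDiscreteValuationRing.addVal O (MvPolynomial.eval z h) := by
  obtain ⟨ϖ, hϖ⟩ := IsDiscreteValuationRing.exists_irreducible O
  have hm (n : ℕ) := (isOpen_dvdSet hϖ h n).measurableSet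
  refine measurable_to_countable' fun w => ?_
  induction w using ENat.recTopCoe with
  | top =>
    have : (fun z : ι → O => IsDiscreteValuationRing.addVal O (MvPolynomial.eval z h)) ⁻¹' {⊤} =
        ⋂ n : ℕ, dvdSet h (ϖ ^ n) := by
      ext z
      simp only [Set.mem_preimage, Set.mem_singleton_iff, Set.mem_iInter, dvdSet,
        Set.mem_ofPred_eq, pow_dvd_iff_le_addVal hϖ]
      exact ENat.eq_top_iff_forall_ge
    rw [this]
    exact MeasurableSet.iInter hm
  | coe n =>
    have : (fun z : ι → O => IsDiscreteValuationRing.addVal O (MvPolynomial.eval z h)) ⁻¹' {(n : ℕ∞)} =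
        dvdSet h (ϖ ^ n) \ dvdSet h (ϖ ^ (n + 1)) := by
      ext z
      simp [dvdSet, addVal_eq_iff_dvd hϖ]
    rw [this]
    exact (hm n).diff (hm (n + 1))

theorem measurable_zetaIntegrand (h : MvPolynomial ι O) (s : ℂ) :
    Measurable (zetaIntegrand h s) := by
  classical
  let G : ℕ∞ → ℂ := fun w => if w = ⊤ then ((absO (0 : O) : ℝ) : ℂ) ^ s else
    ((resCard O : ℂ) ^ (-s)) ^ w.toNat
  have : zetaIntegrand h s = G ∘ fun z : ι → O =>
      IsDiscreteValuationRing.addVal O (MvPolynomial.eval z h) := by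
    ext z
    simp only [zetaIntegrand, Function.comp, G]
    split_ifs with hz
    · rw [IsDiscreteValuationRing.addVal_eq_top_iff.1 hz]
    · exact absO_cpow (ENat.natCast_toNat hz).symm s
  rw [this]
  exact (Measurable.of_discrete (f := G)).comp (measurable_addVal_eval h)

theorem norm_zetaIntegrand_le_one (h : MvPolynomial ι O) {s : ℂ} (hs : 0 < s.re) (z : ι → O) :
    ‖zetaIntegrand h s z‖ ≤ 1 := by
  rw [zetaIntegrand]
  by_cases hz : MvPolynomial.eval z h = 0
  · rw [hz, absO_zero_cpow (by rintro rfl; simp at hs)]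
    simp
  · rw [← IsDiscreteValuationRing.addVal_eq_top_iff.not] at hz
    rw [absO_cpow (ENat.natCast_toNat hz).symm s, norm_pow]
    exact pow_le_one₀ (norm_nonneg _) (norm_resCard_cpow_neg_lt_one hs).le

variable (μ : Measure (ι → O))

theorem integrable_zetaIntegrand [IsFiniteMeasure μ] (h : MvPolynomial ι O) {s : ℂ}
    (hs : 0 < s.re) : Integrable (zetaIntegrand h s) μ :=
  Integrable.of_bound (measurable_zetaIntegrand h s).aestronglyMeasurable 1
    (Filter.Eventually.of_forall (norm_zetaIntegrand_le_one h hs))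

theorem hasSum_setIntegral_zetaIntegrand [IsFiniteMeasure μ] (hϖ : Irreducible ϖ)
    (h : MvPolynomial ι O) {s : ℂ} (hs : 0 < s.re) {U : Set (ι → O)} (hU : MeasurableSet U) :
    HasSum (fun L => ((resCard O : ℂ) ^ (-s)) ^ L *
        ((μ.real (U ∩ dvdSet h (ϖ ^ L)) : ℂ) - μ.real (U ∩ dvdSet h (ϖ ^ (L + 1)))))
      (∫ z in U, zetaIntegrand h s z ∂μ) := by
  let V (L : ℕ) : Set (ι → O) := (U ∩ dvdSet h (ϖ ^ L)) \ (U ∩ dvdSet h (ϖ ^ (L + 1)))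
  have hm (n : ℕ) : MeasurableSet (U ∩ dvdSet h (ϖ ^ n)) :=
    hU.inter (isOpen_dvdSet hϖ h n).measurableSet
  have hV (L z) : z ∈ V L ↔ z ∈ U ∧
      IsDiscreteValuationRing.addVal O (MvPolynomial.eval z h) = L := by
    simp only [V, addVal_eq_iff_dvd hϖ, dvdSet, Set.mem_sdiff, Set.mem_inter_iff, Set.mem_ofPred_eq]
    tauto
  have h1 : ∫ z in U, zetaIntegrand h s z ∂μ = ∫ z in ⋃ L, V L, zetaIntegrand h s z ∂μ := by
    refine setIntegral_eq_of_subset_of_forall_sdiff_eq_zero hU ?_ ?_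
    · exact Set.iUnion_subset fun L z hz => ((hV L z).1 hz).1
    · rintro z ⟨hz, hz'⟩
      have : MvPolynomial.eval z h = 0 := by
        rw [← IsDiscreteValuationRing.addVal_eq_top_iff]
        by_contra h2
        exact hz' (Set.mem_iUnion.2 ⟨_, (hV _ z).2 ⟨hz, (ENat.natCast_toNat h2).symm⟩⟩)
      rw [zetaIntegrand, this, absO_zero_cpow (by rintro rfl; simp at hs)]
  rw [h1]
  convert! hasSum_integral_iUnion (μ := μ) (f := zetaIntegrand h s) (s := V)
    (fun L => (hm L).diff (hm (L + 1))) ?_ (integrable_zetaIntegrand μ h hs).integrableOn using 1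
  · ext L
    change _ = ∫ z in (U ∩ dvdSet h (ϖ ^ L)) \ (U ∩ dvdSet h (ϖ ^ (L + 1))), zetaIntegrand h s z ∂μ
    rw [setIntegral_congr_fun (f := zetaIntegrand h s) (g := fun _ => ((resCard O : ℂ) ^ (-s)) ^ L)
      ((hm L).diff (hm (L + 1))) fun z hz => absO_cpow ((hV L z).1 hz).2 s, setIntegral_const,
      measureReal_sdiff ?_ (hm (L + 1))]
    · simp [mul_comm]
    · refine Set.inter_subset_inter_right _ fun z hz => ?_
      exact (pow_dvd_pow ϖ (Nat.le_succ L)).trans hz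
  · intro L L' hne
    refine Set.disjoint_left.2 fun z hz hz' => hne ?_
    exact_mod_cast ((hV L z).1 hz).2.symm.trans ((hV L' z).1 hz').2

/-- The zeta integral over the unit points is, up to `1 - q ^ (-1 - s)`, a polynomial in
`q ^ (-s)`. -/
theorem setIntegral_unitPts_zetaIntegrand [IsFiniteMeasure μ] [μ.IsAddLeftInvariant]
    (hϖ : Irreducible ϖ)
    (h : MvPolynomial ι O) {s : ℂ} (hs : 0 < s.re) {e M : ℕ} (hM : 2 * e + 1 ≤ M)
    (hder : ∀ z ∈ unitPts O ι, ∃ i, ¬ ϖ ^ (e + 1) ∣ MvPolynomial.eval z (MvPolynomial.pderiv i h)) :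
    (1 - (resCard O : ℂ)⁻¹ * (resCard O : ℂ) ^ (-s)) *
        ∫ z in unitPts O ι, zetaIntegrand h s z ∂μ =
      (1 - (resCard O : ℂ)⁻¹ * (resCard O : ℂ) ^ (-s)) *
        ∑ L ∈ Finset.range M, ((resCard O : ℂ) ^ (-s)) ^ L *
          ((μ.real (unitPts O ι ∩ dvdSet h (ϖ ^ L)) : ℂ) -
            μ.real (unitPts O ι ∩ dvdSet h (ϖ ^ (L + 1)))) +
        ((resCard O : ℂ) ^ (-s)) ^ M * (1 - (resCard O : ℂ)⁻¹) *
          μ.real (unitPts O ι ∩ dvdSet h (ϖ ^ M)) := by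
  have hsum := hasSum_setIntegral_zetaIntegrand μ hϖ h hs
    (isOpen_unitPts (ι := ι) hϖ).measurableSet
  have hT := norm_resCard_cpow_neg_lt_one (O := O) hs
  have hq1 := one_lt_resCard (O := O)
  set T := (resCard O : ℂ) ^ (-s)
  have hq0 : (resCard O : ℂ) ≠ 0 := by
    exact_mod_cast (by omega : resCard O ≠ 0)
  set m := fun L => μ.real (unitPts O ι ∩ dvdSet h (ϖ ^ L)) with hm
  have hstep (L) (hL : M ≤ L) : (m (L + 1) : ℂ) = (resCard O : ℂ)⁻¹ * m L := by
    have := congrArg ENNReal.toReal (measure_unitPts_inter_dvdSet_eq μ hϖ h (hM.trans hL) hder)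
    rw [ENNReal.toReal_mul, ENNReal.toReal_natCast] at this
    have h2 : m L = resCard O * m (L + 1) := this
    rw [h2]
    push_cast
    field_simp
  have hgeom (j) : (m (M + j) : ℂ) = (resCard O : ℂ)⁻¹ ^ j * m M := by
    induction j with
    | zero => simp
    | succ j ih => rw [← add_assoc, hstep _ (by omega), ih, pow_succ]; ring
  have hlt : ‖(resCard O : ℂ)⁻¹ * T‖ < 1 := by
    rw [norm_mul, norm_inv, Complex.norm_natCast]
    have : ((resCard O : ℝ))⁻¹ ≤ 1 := inv_le_one_of_one_le₀ (by exact_mod_cast hq1.le)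
    calc _ ≤ 1 * ‖T‖ := by gcongr
      _ < 1 := by simpa using hT
  have h1 := (hasSum_nat_add_iff' M).2 hsum
  have h2 := (hasSum_geometric_of_norm_lt_one hlt).mul_left (T ^ M * (1 - (resCard O : ℂ)⁻¹) * m M)
  have h3 : (fun j => T ^ (j + M) * ((m (j + M) : ℂ) - m (j + M + 1))) =
      fun j => T ^ M * (1 - (resCard O : ℂ)⁻¹) * m M * ((resCard O : ℂ)⁻¹ * T) ^ j := by
    ext j
    rw [hstep _ (by omega), add_comm j M, hgeom]
    ring
  have h4 := h1.unique (h3 ▸ h2)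
  have h5 : 1 - (resCard O : ℂ)⁻¹ * T ≠ 0 := by
    intro h0
    rw [← sub_eq_zero.1 h0] at hlt
    simp at hlt
  rw [sub_eq_iff_eq_add] at h4
  rw [h4, mul_add, add_comm]
  congr 1
  change _ = T ^ M * (1 - (resCard O : ℂ)⁻¹) * (m M : ℂ)
  rw [mul_comm, mul_assoc, inv_mul_cancel₀ h5, mul_one]

end Integrand

section Shell

variable {O : Type*} [CommRing O] [IsDomain O] [IsDiscreteValuationRing O] {ϖ : O} {ι : Type*}

/-- Multiplication of the `i`-th coordinate by `ϖ ^ κ i`. -/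
def scale (ϖ : O) (κ : ι → ℕ) : (ι → O) →+ (ι → O) := AddMonoidHom.mulLeft fun i => ϖ ^ κ i

@[simp]
theorem scale_apply (κ : ι → ℕ) (z : ι → O) (i : ι) : scale ϖ κ z i = ϖ ^ κ i * z i := rfl

theorem scale_injective (hϖ : Irreducible ϖ) (κ : ι → ℕ) : Function.Injective (scale ϖ κ) :=
  fun _ _ h => funext fun i => mul_left_cancel₀ (pow_ne_zero _ hϖ.ne_zero) (congrFun h i)

theorem shell_singleton_eq (hϖ : Irreducible ϖ) (κ : ι → ℕ) :
    shell {κ} = scale ϖ κ '' unitPts O ι := by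
  ext x
  simp only [shell, Set.mem_singleton_iff, exists_eq_left, Set.mem_ofPred_eq, Set.mem_image]
  constructor
  · intro h
    have h1 (i) : ∃ z, IsUnit z ∧ ϖ ^ κ i * z = x i := by
      obtain ⟨⟨z, hz⟩, h2⟩ := (addVal_eq_iff_dvd hϖ _ _).1 (h i)
      refine ⟨z, (isUnit_iff_not_dvd hϖ z).2 fun ⟨y, hy⟩ => h2 ⟨y, ?_⟩, hz.symm⟩
      rw [hz, hy, pow_succ, mul_assoc]
    choose z hz hzx using h1
    exact ⟨z, hz, funext hzx⟩
  · rintro ⟨z, hz, rfl⟩ i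
    rw [scale_apply, IsDiscreteValuationRing.addVal_mul, hϖ.addVal_pow,
      IsDiscreteValuationRing.addVal_eq_zero_iff.2 (hz i), add_zero]

theorem disjoint_shell {κ κ' : ι → ℕ} (h : κ ≠ κ') :
    Disjoint (shell {κ} : Set (ι → O)) (shell {κ'}) := by
  refine Set.disjoint_left.2 ?_
  rintro x ⟨_, rfl, hx⟩ ⟨_, rfl, hx'⟩
  exact h (funext fun i => by exact_mod_cast (hx i).symm.trans (hx' i))

end Shell

section Scale

variable {O : Type*} [CommRing O] [IsDomain O] [IsDiscreteValuationRing O] [TopologicalSpace O]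
  [IsTopologicalRing O] [CompactSpace O] [T2Space O] {ϖ : O} {ι : Type*} [Fintype ι]
  [MeasurableSpace (ι → O)] [BorelSpace (ι → O)] (μ : Measure (ι → O))

theorem measurableEmbedding_scale (hϖ : Irreducible ϖ) (κ : ι → ℕ) :
    MeasurableEmbedding (scale ϖ κ) := by
  have hc : Continuous (scale ϖ κ) := continuous_const_mul (fun i => ϖ ^ κ i)
  exact (hc.isClosedEmbedding (scale_injective hϖ κ)).measurableEmbedding

theorem measurableSet_shell_singleton (κ : ι → ℕ) :
    MeasurableSet (shell {κ} : Set (ι → O)) := by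
  obtain ⟨ϖ, hϖ⟩ := IsDiscreteValuationRing.exists_irreducible O
  rw [shell_singleton_eq hϖ]
  exact (measurableEmbedding_scale hϖ κ).measurableSet_image.2 (isOpen_unitPts hϖ).measurableSet

variable [μ.IsAddHaarMeasure] [IsProbabilityMeasure μ]

theorem exists_comap_scale_eq (hϖ : Irreducible ϖ) (κ : ι → ℕ) :
    ∃ c : NNReal, μ.comap (scale ϖ κ) = c • μ := by
  have he := measurableEmbedding_scale (ι := ι) hϖ κ
  have := Measure.IsAddLeftInvariant.comap μ he
  have : IsFiniteMeasure (μ.comap (scale ϖ κ)) := by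
    refine ⟨?_⟩
    rw [he.comap_apply]
    exact measure_lt_top _ _
  exact ⟨_, Measure.isAddInvariant_eq_smul_of_compactSpace _ μ⟩

theorem measure_image_scale_of_univ (hϖ : Irreducible ϖ) (κ : ι → ℕ) (S : Set (ι → O)) :
    μ (scale ϖ κ '' S) = μ (scale ϖ κ '' Set.univ) * μ S := by
  obtain ⟨c, hc⟩ := exists_comap_scale_eq μ hϖ κ
  have he := measurableEmbedding_scale (ι := ι) hϖ κ
  rw [← he.comap_apply, ← he.comap_apply, hc]
  simp [Measure.smul_apply]

theorem measure_range_scale_single [DecidableEq ι] (hϖ : Irreducible ϖ) (i : ι) :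
    resCard O * μ (scale ϖ (Pi.single i 1) '' Set.univ) = 1 := by
  have : Fintype (IsLocalRing.ResidueField O) := Fintype.ofFinite _
  let F (ρ : IsLocalRing.ResidueField O) : Set (ι → O) := {z | IsLocalRing.residue O (z i) = ρ}
  have hF0 : scale ϖ (Pi.single i 1) '' Set.univ = F 0 := by
    ext z
    simp only [Set.image_univ, Set.mem_range, F, Set.mem_ofPred_eq, residue_eq_zero_iff_dvd hϖ]
    constructor
    · rintro ⟨y, rfl⟩
      simp
    · rintro ⟨y, hy⟩
      refine ⟨Function.update z i y, funext fun j => ?_⟩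
      by_cases hj : j = i
      · subst hj; simp [hy]
      · simp [hj]
  have hF (ρ) : ∃ v : ι → O, (v + ·) ⁻¹' F ρ = F 0 := by
    obtain ⟨t, rfl⟩ := IsLocalRing.residue_surjective (R := O) ρ
    refine ⟨Pi.single i t, ?_⟩
    ext z
    simp [F]
  have hmeas0 : MeasurableSet (F 0) := by
    rw [← hF0]
    exact (measurableEmbedding_scale hϖ _).measurableSet_image.2 MeasurableSet.univ
  have hmeas (ρ) : MeasurableSet (F ρ) := by
    obtain ⟨v, hv⟩ := hF ρ
    have : F ρ = (-v + ·) ⁻¹' F 0 := by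
      rw [← hv]; ext z; simp
    rw [this]
    exact measurable_const_add (-v) hmeas0
  have hμ (ρ) : μ (F ρ) = μ (F 0) := by
    obtain ⟨v, hv⟩ := hF ρ
    rw [← hv, measure_preimage_add]
  have hU : (⋃ ρ, F ρ) = Set.univ := Set.eq_univ_of_forall fun z => Set.mem_iUnion.2 ⟨_, rfl⟩
  have hd : Pairwise (Function.onFun Disjoint F) := fun ρ ρ' hne =>
    Set.disjoint_left.2 fun z hz hz' => hne (hz.symm.trans hz')
  rw [hF0, ← measure_univ (μ := μ), ← hU, measure_iUnion hd hmeas, tsum_fintype]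
  simp [hμ, resCard, Nat.card_eq_fintype_card]

theorem measure_range_scale (hϖ : Irreducible ϖ) (κ : ι → ℕ) :
    (resCard O : ENNReal) ^ (∑ i, κ i) * μ (scale ϖ κ '' Set.univ) = 1 := by
  classical
  have hadd (κ κ' : ι → ℕ) : scale ϖ (κ + κ') '' Set.univ =
      scale ϖ κ '' (scale ϖ κ' '' Set.univ) := by
    rw [Set.image_image]
    congr 1
    ext z i
    simp [pow_add, mul_assoc]
  induction hn : ∑ i, κ i generalizing κ with
  | zero =>
    have h0 : κ = 0 := funext fun i => by
      simpa using (Finset.sum_eq_zero_iff.1 hn) i (Finset.mem_univ i)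
    have : scale ϖ κ '' Set.univ = Set.univ := by
      rw [h0]
      refine Set.eq_univ_of_forall fun z => ⟨z, trivial, funext fun i => by simp⟩
    rw [this, measure_univ, pow_zero, one_mul]
  | succ n ih =>
    obtain ⟨i, hi⟩ : ∃ i, κ i ≠ 0 := by
      by_contra! h
      simp [h] at hn
    have hk : κ = Pi.single i 1 + (κ - Pi.single i 1) := by
      ext j
      by_cases hj : j = i
      · subst hj; simp; omega
      · simp [hj]
    have hs : ∑ j, (κ - Pi.single i 1 : ι → ℕ) j = n := by
      have : ∑ j, κ j = ∑ j, (Pi.single i 1 : ι → ℕ) j + ∑ j, (κ - Pi.single i 1 : ι → ℕ) j := by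
        rw [← Finset.sum_add_distrib]
        exact Finset.sum_congr rfl fun j _ => congrFun hk j
      rw [hn, Finset.sum_pi_single'] at this
      simp at this
      simp only [Pi.sub_apply]
      omega
    have h1 := ih _ hs
    have h2 := measure_range_scale_single μ hϖ i
    rw [hk, hadd, measure_image_scale_of_univ μ hϖ, pow_succ]
    calc _ = (resCard O * μ (scale ϖ (Pi.single i 1) '' Set.univ)) *
          ((resCard O : ENNReal) ^ n * μ (scale ϖ (κ - Pi.single i 1) '' Set.univ)) := by ring
      _ = 1 := by rw [h1, h2, one_mul]

theorem setIntegral_shell_singleton (hϖ : Irreducible ϖ) (κ : ι → ℕ) (G : (ι → O) → ℂ) :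
    ∫ x in shell {κ}, G x ∂μ =
      ((resCard O : ℂ)⁻¹) ^ (∑ i, κ i) * ∫ z in unitPts O ι, G (scale ϖ κ z) ∂μ := by
  have he := measurableEmbedding_scale (ι := ι) hϖ κ
  obtain ⟨c, hc⟩ := exists_comap_scale_eq μ hϖ κ
  have hcv : (c : ENNReal) = μ (scale ϖ κ '' Set.univ) := by
    rw [← he.comap_apply, hc]
    simp [Measure.smul_apply]
  have hc' : (c : ℂ) = ((resCard O : ℂ)⁻¹) ^ (∑ i, κ i) := by
    have h1 := measure_range_scale μ hϖ κ
    rw [← hcv] at h1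
    have h2 : (resCard O : NNReal) ^ (∑ i, κ i) * c = 1 := by exact_mod_cast h1
    have h3 : (resCard O : ℂ) ^ (∑ i, κ i) * (c : ℂ) = 1 := by exact_mod_cast congrArg (fun x : NNReal => ((x : ℝ) : ℂ)) h2
    rw [inv_pow]
    exact eq_inv_of_mul_eq_one_right h3
  have hsub : scale ϖ κ '' unitPts O ι ⊆ Set.range (scale ϖ κ) := Set.image_subset_range _ _
  rw [shell_singleton_eq hϖ]
  calc _ = ∫ x in scale ϖ κ '' unitPts O ι, G x ∂(μ.restrict (Set.range (scale ϖ κ))) := by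
        rw [Measure.restrict_restrict_of_subset hsub]
    _ = ∫ z in unitPts O ι, G (scale ϖ κ z) ∂(c • μ) := by
        rw [← he.map_comap, he.setIntegral_map, Set.preimage_image_eq _ he.injective, hc]
    _ = _ := by
        rw [Measure.restrict_smul, integral_smul_nnreal_measure, ← hc']
        rfl

end Scale

section EventualVanishing

open Filter

variable {ι A : Type*} [CommRing A]

/-- A filter on exponents that is preserved by truncated subtraction of a fixed exponent. -/
def ShiftStable (F : Filter (ι →₀ ℕ)) : Prop := ∀ r : ι →₀ ℕ, Tendsto (fun κ => κ - r) F F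

/-- The filter of exponents whose `l`-th entry tends to infinity. -/
def entryAtTop (l : ι) : Filter (ι →₀ ℕ) := comap (fun κ => κ l) atTop

theorem shiftStable_entryAtTop (l : ι) : ShiftStable (entryAtTop l) := by
  intro r
  refine tendsto_comap_iff.2 ?_
  exact (tendsto_sub_atTop_nat (r l)).comp tendsto_comap

theorem ShiftStable.inf {F G : Filter (ι →₀ ℕ)} (hF : ShiftStable F) (hG : ShiftStable G) :
    ShiftStable (F ⊓ G) := fun r => (hF r).inf (hG r)

theorem shiftStable_principal_forall_lt (J : Set ι) (N : ℕ) :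
    ShiftStable (𝓟 {κ : ι →₀ ℕ | ∀ j ∈ J, κ j < N}) := by
  intro r
  refine tendsto_principal_principal.2 fun κ hκ j hj => ?_
  have := hκ j hj
  simp only [Finsupp.coe_tsub, Pi.sub_apply]
  omega

theorem eventually_coeff_mul_eq_zero {F : Filter (ι →₀ ℕ)} (hF : ShiftStable F)
    (p : MvPolynomial ι A) {Φ : MvPowerSeries ι A}
    (hΦ : ∀ᶠ κ in F, MvPowerSeries.coeff κ Φ = 0) :
    ∀ᶠ κ in F, MvPowerSeries.coeff κ ((p : MvPowerSeries ι A) * Φ) = 0 := by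
  classical
  have h : ∀ᶠ κ in F, ∀ r ∈ p.support, MvPowerSeries.coeff (κ - r) Φ = 0 :=
    (Finset.eventually_all _).2 fun r _ => (hF r).eventually hΦ
  filter_upwards [h] with κ hκ
  rw [MvPowerSeries.coeff_mul]
  refine Finset.sum_eq_zero fun x hx => ?_
  rw [MvPolynomial.coeff_coe]
  by_cases hp : x.1 ∈ p.support
  · rw [← Finset.HasAntidiagonal.mem_antidiagonal.1 hx] at hκ
    have := hκ _ hp
    rw [add_tsub_cancel_left] at this
    rw [this, mul_zero]
  · rw [MvPolynomial.notMem_support_iff.1 hp, zero_mul]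

theorem eventually_of_inf_entryAtTop {F : Filter (ι →₀ ℕ)} {J : Set ι} (hJ : J.Finite)
    {P : (ι →₀ ℕ) → Prop} (h1 : ∀ j ∈ J, ∀ᶠ κ in F ⊓ entryAtTop j, P κ)
    (h2 : ∀ N, ∀ᶠ κ in F ⊓ 𝓟 {κ | ∀ j ∈ J, κ j < N}, P κ) : ∀ᶠ κ in F, P κ := by
  have h3 (j) (hj : j ∈ J) : ∃ N, ∀ᶠ κ in F, N ≤ κ j → P κ := by
    obtain ⟨s, hs, t, ht, hst⟩ := mem_inf_iff_superset.1 (h1 j hj)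
    obtain ⟨N, hN⟩ := mem_atTop_sets.1 (mem_comap.1 ht).choose_spec.1
    refine ⟨N, ?_⟩
    filter_upwards [hs] with κ hκ hle
    exact hst ⟨hκ, (mem_comap.1 ht).choose_spec.2 (hN _ hle)⟩
  choose! N hN using h3
  obtain ⟨N0, hN0⟩ : ∃ N0, ∀ j ∈ J, N j ≤ N0 := by
    obtain ⟨N0, h⟩ := (hJ.image N).bddAbove
    exact ⟨N0, fun j hj => h ⟨j, hj, rfl⟩⟩
  have h4 := eventually_inf_principal.1 (h2 N0)
  filter_upwards [h4, (hJ.eventually_all).2 hN] with κ h5 h6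
  by_cases h7 : ∀ j ∈ J, κ j < N0
  · exact h5 h7
  · push Not at h7
    obtain ⟨j, hj, hjN⟩ := h7
    exact h6 j hj ((hN0 j hj).trans hjN)

theorem eventually_entryAtTop {l : ι} {P : (ι →₀ ℕ) → Prop} (N : ℕ) (h : ∀ κ, N ≤ κ l → P κ) :
    ∀ᶠ κ in entryAtTop l, P κ := by
  filter_upwards [tendsto_comap.eventually (eventually_ge_atTop N)] with κ hκ using h κ hκ

theorem exists_of_eventually_entryAtTop {l : ι} {P : (ι →₀ ℕ) → Prop}
    (h : ∀ᶠ κ in entryAtTop l, P κ) : ∃ N, ∀ κ, N ≤ κ l → P κ := by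
  obtain ⟨N, hN⟩ := mem_atTop_sets.1 (mem_comap.1 h).choose_spec.1
  exact ⟨N, fun κ hκ => (mem_comap.1 h).choose_spec.2 (hN _ hκ)⟩

theorem finite_support_of_eventually [Finite ι] {Φ : MvPowerSeries ι A}
    (h : ∀ l, ∀ᶠ κ in entryAtTop l, MvPowerSeries.coeff κ Φ = 0) :
    {κ | MvPowerSeries.coeff κ Φ ≠ 0}.Finite := by
  classical
  have := Fintype.ofFinite ι
  choose N hN using fun l => exists_of_eventually_entryAtTop (h l)
  refine (Set.finite_Icc 0 (Finsupp.equivFunOnFinite.symm N)).subset fun κ hκ =>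
    ⟨zero_le, fun l => ?_⟩
  by_contra hlt
  exact hκ (hN l κ (not_le.1 hlt).le)

end EventualVanishing

section Evaluation

variable {ι A : Type*} [Fintype ι] [CommRing A]

theorem hasSum_coeff_mul (ev : A →+* ℂ) (z : ι → ℂ) (p : MvPolynomial ι A)
    {Φ : MvPowerSeries ι A} {S : ℂ}
    (h : HasSum (fun κ => ev (MvPowerSeries.coeff κ Φ) * ∏ l, z l ^ κ l) S) :
    HasSum (fun κ => ev (MvPowerSeries.coeff κ ((p : MvPowerSeries ι A) * Φ)) *
      ∏ l, z l ^ κ l)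
      (MvPolynomial.eval₂ ev z p * S) := by
  classical
  induction p using MvPolynomial.induction_on with
  | C a =>
    simp only [MvPolynomial.coe_C, MvPowerSeries.coeff_C_mul, MvPolynomial.eval₂_C, map_mul,
      mul_assoc]
    exact h.mul_left _
  | add p q hp hq =>
    simp only [MvPolynomial.coe_add, add_mul, map_add, MvPolynomial.eval₂_add]
    exact hp.add hq
  | mul_X p i hp =>
    have h1 : ((p * MvPolynomial.X i : MvPolynomial ι A) : MvPowerSeries ι A) * Φ =
        MvPowerSeries.monomial (Finsupp.single i 1) 1 *
          ((p : MvPowerSeries ι A) * Φ) := by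
      rw [MvPolynomial.coe_mul, MvPolynomial.coe_X, MvPowerSeries.X_def]
      ring
    rw [h1, MvPolynomial.eval₂_mul, MvPolynomial.eval₂_X]
    have hinj : Function.Injective fun κ : ι →₀ ℕ => Finsupp.single i 1 + κ :=
      add_right_injective _
    refine (hinj.hasSum_iff ?_).1 ?_
    · intro κ hκ
      have : ¬ Finsupp.single i 1 ≤ κ := fun hle => hκ ⟨κ - Finsupp.single i 1, by
        simp only; rw [add_tsub_cancel_of_le hle]⟩
      rw [MvPowerSeries.coeff_monomial_mul, if_neg this, map_zero, zero_mul]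
    · convert! hp.mul_left (z i) using 1
      · ext κ
        have : ∏ l, z l ^ (Finsupp.single i 1 + κ : ι →₀ ℕ) l = z i * ∏ l, z l ^ κ l := by
          simp only [Finsupp.add_apply, pow_add, Finset.prod_mul_distrib]
          congr 1
          rw [Finset.prod_eq_single i (fun b _ hb => by simp [Finsupp.single_eq_of_ne hb]) (by simp)]
          simp
        simp only [Function.comp]
        rw [MvPowerSeries.coeff_add_monomial_mul, one_mul, this]
        ring
      · ring

end Evaluation

section Rationality

open Filter

variable {ι A : Type*} [Fintype ι] [CommRing A]

/-- The factor `1 - T ^ lcm (c i, d j) X_i ^ (d j / g) X_j ^ (c i / g)`, `g = gcd (c i, d j)`, or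
`1` if `c i = 0` or `d j = 0`. -/
def rayFactor (T : A) (c d : ι → ℕ) (i j : ι) : MvPolynomial ι A :=
  if 0 < c i ∧ 0 < d j then
    1 - MvPolynomial.monomial (Finsupp.single i (d j / (c i).gcd (d j)) +
      Finsupp.single j (c i / (c i).gcd (d j))) (T ^ (c i).lcm (d j))
  else 1

theorem coeff_one_sub_monomial_mul (r : ι →₀ ℕ) (a : A) (Φ : MvPowerSeries ι A) (κ : ι →₀ ℕ) :
    MvPowerSeries.coeff (r + κ)
      (((1 - MvPolynomial.monomial r a : MvPolynomial ι A) : MvPowerSeries ι A) * Φ) =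
      MvPowerSeries.coeff (r + κ) Φ - a * MvPowerSeries.coeff κ Φ := by
  have : ((1 - MvPolynomial.monomial r a : MvPolynomial ι A) : MvPowerSeries ι A) =
      1 - MvPowerSeries.monomial r a := by
    rw [← MvPolynomial.coe_monomial]
    exact map_sub (MvPolynomial.coeToMvPowerSeries.ringHom (σ := ι) (R := A)) _ _ |>.trans (by simp)
  rw [this, sub_mul, one_mul, map_sub, MvPowerSeries.coeff_add_monomial_mul]

/-- `∑ κ_l c_l`. -/
def dotNat (c : ι → ℕ) (κ : ι →₀ ℕ) : ℕ := ∑ l, κ l * c l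

theorem dotNat_add (c : ι → ℕ) (κ κ' : ι →₀ ℕ) : dotNat c (κ + κ') = dotNat c κ + dotNat c κ' := by
  simp [dotNat, add_mul, Finset.sum_add_distrib]

theorem dotNat_single (c : ι → ℕ) (i : ι) (n : ℕ) : dotNat c (Finsupp.single i n) = n * c i := by
  classical
  simp [dotNat, Finsupp.single_apply, Finset.sum_ite_eq]

theorem le_dotNat {c : ι → ℕ} {i : ι} (hi : 0 < c i) (κ : ι →₀ ℕ) : κ i ≤ dotNat c κ :=
  (Nat.le_mul_of_pos_right _ hi).trans
    (Finset.single_le_sum (f := fun l => κ l * c l) (fun _ _ => Nat.zero_le _) (Finset.mem_univ i))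

theorem dotNat_ray_left {c d : ι → ℕ} (hcd : ∀ l, c l = 0 ∨ d l = 0) {i j : ι}
    (hj : 0 < d j) : dotNat c (Finsupp.single i (d j / (c i).gcd (d j)) +
      Finsupp.single j (c i / (c i).gcd (d j))) = (c i).lcm (d j) := by
  rw [dotNat_add, dotNat_single, dotNat_single, (hcd j).resolve_right hj.ne', mul_zero, add_zero,
    Nat.lcm, Nat.mul_div_assoc _ (Nat.gcd_dvd_right _ _), mul_comm]

theorem dotNat_ray_right {c d : ι → ℕ} (hcd : ∀ l, c l = 0 ∨ d l = 0) {i j : ι}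
    (hi : 0 < c i) : dotNat d (Finsupp.single i (d j / (c i).gcd (d j)) +
      Finsupp.single j (c i / (c i).gcd (d j))) = (c i).lcm (d j) := by
  rw [add_comm, Nat.gcd_comm, Nat.lcm_comm]
  exact dotNat_ray_left (fun l => (hcd l).symm) hi

/-- The function `Q` on exponents is invariant under the shifts that keep `∑ κ_l c_l - ∑ κ_l d_l`,
truncated to `[-M, M]`, and the truncation of `κ` by `M`. -/
structure IsTruncInvariant (Q : (ι →₀ ℕ) → A) (c d : ι → ℕ) (M : ℕ) : Prop where
  ray : ∀ i j κ, 0 < c i → 0 < d j → M ≤ κ i → M ≤ κ j →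
    Q (Finsupp.single i (d j / (c i).gcd (d j)) + Finsupp.single j (c i / (c i).gcd (d j)) + κ) =
      Q κ
  zero : ∀ i κ, c i = 0 → d i = 0 → M ≤ κ i → Q (Finsupp.single i 1 + κ) = Q κ
  left : ∀ i κ, 0 < c i → M ≤ κ i → dotNat d κ + M ≤ dotNat c κ →
    Q (Finsupp.single i 1 + κ) = Q κ
  right : ∀ i κ, 0 < d i → M ≤ κ i → dotNat c κ + M ≤ dotNat d κ →
    Q (Finsupp.single i 1 + κ) = Q κ

/-- The series `∑ T ^ min (∑ κ_l c_l, ∑ κ_l d_l) Q(κ) X ^ κ`. -/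
def minSeries (T : A) (c d : ι → ℕ) (Q : (ι →₀ ℕ) → A) : MvPowerSeries ι A :=
  fun κ => T ^ min (dotNat c κ) (dotNat d κ) * Q κ

theorem coeff_minSeries (T : A) (c d : ι → ℕ) (Q : (ι →₀ ℕ) → A) (κ : ι →₀ ℕ) :
    MvPowerSeries.coeff κ (minSeries T c d Q) = T ^ min (dotNat c κ) (dotNat d κ) * Q κ := rfl

theorem eventually_coeff_rayFactor_mul {Q : (ι →₀ ℕ) → A} {c d : ι → ℕ} {M : ℕ} (T : A)
    (hcd : ∀ l, c l = 0 ∨ d l = 0)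
    (hQ : IsTruncInvariant Q c d M) {i j : ι} (hi : 0 < c i) (hj : 0 < d j) :
    ∀ᶠ κ in entryAtTop i ⊓ entryAtTop j,
      MvPowerSeries.coeff κ ((rayFactor T c d i j : MvPowerSeries ι A) * minSeries T c d Q) = 0 := by
  classical
  have hij : i ≠ j := by
    rintro rfl
    rcases hcd i with h | h <;> omega
  set g := (c i).gcd (d j)
  set r : ι →₀ ℕ := Finsupp.single i (d j / g) + Finsupp.single j (c i / g) with hr
  have hri : r i = d j / g := by simp [hr, Finsupp.single_eq_of_ne hij]
  have hrj : r j = c i / g := by simp [hr, Finsupp.single_eq_of_ne hij.symm]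
  have h1 : ∀ᶠ κ in entryAtTop i ⊓ entryAtTop j, M + r i ≤ κ i :=
    (eventually_entryAtTop (l := i) _ fun κ h => h).filter_mono inf_le_left
  have h2 : ∀ᶠ κ in entryAtTop i ⊓ entryAtTop j, M + r j ≤ κ j :=
    (eventually_entryAtTop (l := j) _ fun κ h => h).filter_mono inf_le_right
  filter_upwards [h1, h2] with κ hκi hκj
  have hle : r ≤ κ := by
    intro l
    by_cases h : l = i
    · subst h; omega
    by_cases h' : l = j
    · subst h'; omega
    · simp [hr, Finsupp.single_eq_of_ne h, Finsupp.single_eq_of_ne h']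
  obtain ⟨κ, rfl⟩ : ∃ κ', κ = r + κ' := ⟨κ - r, (add_tsub_cancel_of_le hle).symm⟩
  rw [Finsupp.add_apply r κ] at hκi hκj
  have hc : dotNat c r = (c i).lcm (d j) := dotNat_ray_left hcd hj
  have hd : dotNat d r = (c i).lcm (d j) := dotNat_ray_right hcd hi
  rw [rayFactor, if_pos ⟨hi, hj⟩, coeff_one_sub_monomial_mul, coeff_minSeries, coeff_minSeries,
    hQ.ray i j κ hi hj (by omega) (by omega)]
  rw [dotNat_add c r, dotNat_add d r, hc, hd, Nat.add_min_add_left, pow_add]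
  ring

theorem eventually_coeff_one_sub_X_mul_of_zero {Q : (ι →₀ ℕ) → A} {c d : ι → ℕ} {M : ℕ} (T : A)
    (hQ : IsTruncInvariant Q c d M) {i : ι} (hi : c i = 0) (hi' : d i = 0) :
    ∀ᶠ κ in entryAtTop i, MvPowerSeries.coeff κ
      (((1 - MvPolynomial.monomial (Finsupp.single i 1) 1 : MvPolynomial ι A) : MvPowerSeries ι A) *
        minSeries T c d Q) = 0 := by
  refine eventually_entryAtTop (M + 1) fun κ hκ => ?_
  obtain ⟨κ, rfl⟩ : ∃ κ', κ = Finsupp.single i 1 + κ' :=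
    ⟨κ - Finsupp.single i 1, (add_tsub_cancel_of_le (by simp; omega)).symm⟩
  simp only [Finsupp.add_apply, Finsupp.single_eq_same] at hκ
  rw [coeff_one_sub_monomial_mul, coeff_minSeries, coeff_minSeries, hQ.zero i κ hi hi' (by omega),
    dotNat_add, dotNat_add, dotNat_single, dotNat_single, hi, hi']
  simp

theorem IsTruncInvariant.symm {Q : (ι →₀ ℕ) → A} {c d : ι → ℕ} {M : ℕ}
    (hQ : IsTruncInvariant Q c d M) : IsTruncInvariant Q d c M where
  ray i j κ hi hj hκi hκj := by
    rw [add_comm (Finsupp.single i _), Nat.gcd_comm]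
    exact hQ.ray j i κ hj hi hκj hκi
  zero i κ h h' := hQ.zero i κ h' h
  left := hQ.right
  right := hQ.left

theorem minSeries_symm (T : A) (c d : ι → ℕ) (Q : (ι →₀ ℕ) → A) :
    minSeries T c d Q = minSeries T d c Q := by
  ext κ
  rw [coeff_minSeries, coeff_minSeries, min_comm]

theorem eventually_coeff_one_sub_X_mul {Q : (ι →₀ ℕ) → A} {c d : ι → ℕ} {M : ℕ} (T : A)
    (hcd : ∀ l, c l = 0 ∨ d l = 0)
    (hQ : IsTruncInvariant Q c d M) {i : ι} (hi : 0 < c i) (N : ℕ) :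
    ∀ᶠ κ in entryAtTop i ⊓ 𝓟 {κ | ∀ j ∈ {j | 0 < d j}, κ j < N}, MvPowerSeries.coeff κ
      (((1 - MvPolynomial.monomial (Finsupp.single i 1) 1 : MvPolynomial ι A) : MvPowerSeries ι A) *
        minSeries T c d Q) = 0 := by
  refine eventually_inf_principal.2 (eventually_entryAtTop (∑ l, N * d l + M + 1) fun κ hκ hN => ?_)
  obtain ⟨κ, rfl⟩ : ∃ κ', κ = Finsupp.single i 1 + κ' :=
    ⟨κ - Finsupp.single i 1, (add_tsub_cancel_of_le (by simp; omega)).symm⟩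
  simp only [Finsupp.add_apply, Finsupp.single_eq_same] at hκ
  have hd : dotNat d κ ≤ ∑ l, N * d l := by
    refine Finset.sum_le_sum fun l _ => ?_
    rcases Nat.eq_zero_or_pos (d l) with h | h
    · simp [h]
    · have := hN l h
      rw [Finsupp.add_apply] at this
      exact Nat.mul_le_mul_right _ (by omega)
  have hc := le_dotNat hi κ
  have hdi : d i = 0 := (hcd i).resolve_left hi.ne'
  rw [coeff_one_sub_monomial_mul, coeff_minSeries, coeff_minSeries,
    hQ.left i κ hi (by omega) (by omega),
    dotNat_add, dotNat_add, dotNat_single, dotNat_single, hdi, min_eq_right (by omega),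
    min_eq_right (by omega)]
  simp

/-- The common denominator. -/
def rayDenom (T : A) (c d : ι → ℕ) : MvPolynomial ι A :=
  (∏ l, (1 - MvPolynomial.monomial (Finsupp.single l 1) 1)) * ∏ i, ∏ j, rayFactor T c d i j

theorem rayFactor_symm (T : A) (c d : ι → ℕ) (i j : ι) :
    rayFactor T c d i j = rayFactor T d c j i := by
  rw [rayFactor, rayFactor, Nat.gcd_comm, Nat.lcm_comm, add_comm (Finsupp.single i _)]
  simp only [and_comm]

theorem rayDenom_symm (T : A) (c d : ι → ℕ) : rayDenom T c d = rayDenom T d c := by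
  rw [rayDenom, rayDenom, Finset.prod_comm]
  simp only [rayFactor_symm T c d]

theorem rayFactor_dvd_rayDenom (T : A) (c d : ι → ℕ) (i j : ι) :
    rayFactor T c d i j ∣ rayDenom T c d :=
  Dvd.dvd.mul_left ((Finset.dvd_prod_of_mem _ (Finset.mem_univ j)).trans
    (Finset.dvd_prod_of_mem (fun i => ∏ j, rayFactor T c d i j) (Finset.mem_univ i))) _

theorem one_sub_X_dvd_rayDenom (T : A) (c d : ι → ℕ) (i : ι) :
    1 - MvPolynomial.monomial (Finsupp.single i 1) 1 ∣ rayDenom T c d :=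
  Dvd.dvd.mul_right (Finset.dvd_prod_of_mem (fun l : ι => (1 - MvPolynomial.monomial
    (Finsupp.single l 1) 1 : MvPolynomial ι A)) (Finset.mem_univ i)) _

theorem eventually_coeff_mul_of_dvd {F : Filter (ι →₀ ℕ)} (hF : ShiftStable F)
    {p q : MvPolynomial ι A} (hpq : p ∣ q) {Φ : MvPowerSeries ι A}
    (hΦ : ∀ᶠ κ in F, MvPowerSeries.coeff κ ((p : MvPowerSeries ι A) * Φ) = 0) :
    ∀ᶠ κ in F, MvPowerSeries.coeff κ ((q : MvPowerSeries ι A) * Φ) = 0 := by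
  obtain ⟨r, rfl⟩ := hpq
  rw [mul_comm p, MvPolynomial.coe_mul, mul_assoc]
  exact eventually_coeff_mul_eq_zero hF r hΦ

theorem eventually_coeff_rayDenom_mul_of_pos {Q : (ι →₀ ℕ) → A} {c d : ι → ℕ} {M : ℕ} (T : A)
    (hcd : ∀ l, c l = 0 ∨ d l = 0) (hQ : IsTruncInvariant Q c d M) {i : ι} (hi : 0 < c i) :
    ∀ᶠ κ in entryAtTop i,
      MvPowerSeries.coeff κ ((rayDenom T c d : MvPowerSeries ι A) * minSeries T c d Q) = 0 := by
  refine eventually_of_inf_entryAtTop (Set.toFinite {j | 0 < d j}) (fun j hj => ?_) fun N => ?_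
  · exact eventually_coeff_mul_of_dvd ((shiftStable_entryAtTop i).inf (shiftStable_entryAtTop j))
      (rayFactor_dvd_rayDenom T c d i j) (eventually_coeff_rayFactor_mul T hcd hQ hi hj)
  · exact eventually_coeff_mul_of_dvd
      ((shiftStable_entryAtTop i).inf (shiftStable_principal_forall_lt _ N))
      (one_sub_X_dvd_rayDenom T c d i) (eventually_coeff_one_sub_X_mul T hcd hQ hi N)

theorem finite_support_rayDenom_mul {Q : (ι →₀ ℕ) → A} {c d : ι → ℕ} {M : ℕ} (T : A)
    (hcd : ∀ l, c l = 0 ∨ d l = 0) (hQ : IsTruncInvariant Q c d M) :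
    {κ | MvPowerSeries.coeff κ
      ((rayDenom T c d : MvPowerSeries ι A) * minSeries T c d Q) ≠ 0}.Finite := by
  refine finite_support_of_eventually fun i => ?_
  rcases Nat.eq_zero_or_pos (c i) with hc | hc
  · rcases Nat.eq_zero_or_pos (d i) with hd | hd
    · exact eventually_coeff_mul_of_dvd (shiftStable_entryAtTop i)
        (one_sub_X_dvd_rayDenom T c d i) (eventually_coeff_one_sub_X_mul_of_zero T hQ hc hd)
    · rw [minSeries_symm, rayDenom_symm]
      exact eventually_coeff_rayDenom_mul_of_pos T (fun l => (hcd l).symm) hQ.symm hd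
  · exact eventually_coeff_rayDenom_mul_of_pos T hcd hQ hc

open Polynomial in
theorem exists_polynomial_of_isTruncInvariant {Q : (ι →₀ ℕ) → ℚ[X]} {c d : ι → ℕ} {M : ℕ}
    (hcd : ∀ l, c l = 0 ∨ d l = 0) (hQ : IsTruncInvariant Q c d M) (z : ι → ℚ) :
    ∃ P : ℚ[X], ∀ t S : ℂ,
      HasSum (fun κ : ι →₀ ℕ => t ^ min (dotNat c κ) (dotNat d κ) * aeval t (Q κ) *
        ∏ l, (z l : ℂ) ^ κ l) S →
      (∏ l, (1 - (z l : ℂ))) * (∏ i, ∏ j, MvPolynomial.eval₂ (aeval t : ℚ[X] →ₐ[ℚ] ℂ).toRingHom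
        (fun l => (z l : ℂ)) (rayFactor X c d i j)) * S = aeval t P := by
  have hfin := finite_support_rayDenom_mul (X : ℚ[X]) hcd hQ
  refine ⟨∑ κ ∈ hfin.toFinset, MvPowerSeries.coeff κ
    (((rayDenom X c d : MvPolynomial ι ℚ[X]) : MvPowerSeries ι ℚ[X]) * minSeries X c d Q) * C (∏ l, z l ^ κ l),
    fun t S hS => ?_⟩
  have h1 := hasSum_coeff_mul (aeval t : ℚ[X] →ₐ[ℚ] ℂ).toRingHom (fun l => (z l : ℂ))
    (rayDenom X c d) (Φ := minSeries X c d Q) (S := S) (by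
      convert! hS using 2 with κ
      rw [coeff_minSeries]
      simp)
  have h2 := hasSum_sum_of_ne_finset_zero (L := .unconditional _) (s := hfin.toFinset)
    (f := fun κ => (aeval t : ℚ[X] →ₐ[ℚ] ℂ).toRingHom (MvPowerSeries.coeff κ
      (((rayDenom X c d : MvPolynomial ι ℚ[X]) : MvPowerSeries ι ℚ[X]) * minSeries X c d Q)) * ∏ l, (z l : ℂ) ^ κ l)
    (fun κ hκ => by
      have : MvPowerSeries.coeff κ
          (((rayDenom X c d : MvPolynomial ι ℚ[X]) : MvPowerSeries ι ℚ[X]) * minSeries X c d Q) = 0 := by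
        simpa using hκ
      rw [this, map_zero, zero_mul])
  have h3 := h1.unique h2
  have h4 : MvPolynomial.eval₂ (aeval t : ℚ[X] →ₐ[ℚ] ℂ).toRingHom (fun l => (z l : ℂ))
      (∏ l, (1 - MvPolynomial.monomial (Finsupp.single l 1) 1)) = ∏ l, (1 - (z l : ℂ)) := by
    rw [MvPolynomial.eval₂_prod]
    refine Finset.prod_congr rfl fun l _ => ?_
    rw [MvPolynomial.eval₂_sub, MvPolynomial.eval₂_one, MvPolynomial.eval₂_monomial]
    simp
  have h5 : MvPolynomial.eval₂ (aeval t : ℚ[X] →ₐ[ℚ] ℂ).toRingHom (fun l => (z l : ℂ))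
      (rayDenom X c d) = (∏ l, (1 - (z l : ℂ))) * ∏ i, ∏ j, MvPolynomial.eval₂
        (aeval t : ℚ[X] →ₐ[ℚ] ℂ).toRingHom (fun l => (z l : ℂ)) (rayFactor X c d i j) := by
    rw [rayDenom, MvPolynomial.eval₂_mul, h4]
    simp only [MvPolynomial.eval₂_prod]
  rw [← h5, h3, map_sum]
  refine Finset.sum_congr rfl fun κ _ => ?_
  generalize MvPowerSeries.coeff κ
    (((rayDenom X c d : MvPolynomial ι ℚ[X]) : MvPowerSeries ι ℚ[X]) * minSeries X c d Q) = p
  rw [map_mul, aeval_C, eq_ratCast]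
  push_cast
  rfl

end Rationality

section Polyhedron

variable {σ : Type*} [Fintype σ] {R : Type*} [CommRing R] {f : MvPolynomial σ R}

/-- The linear functional `x ↦ a · x`. -/
def dotLin (a : σ → ℝ) : (σ → ℝ) →ₗ[ℝ] ℝ where
  toFun x := a ⬝ᵥ x
  map_add' := dotProduct_add a
  map_smul' c x := dotProduct_smul c a x

@[simp]
theorem dotLin_apply (a x : σ → ℝ) : dotLin a x = a ⬝ᵥ x := rfl

theorem add_mem_newtonPolyhedron {x w : σ → ℝ} (hx : x ∈ newtonPolyhedron f) (hw : 0 ≤ w) :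
    x + w ∈ newtonPolyhedron f := by
  have hconv : Convex ℝ {x : σ → ℝ | x + w ∈ newtonPolyhedron f} :=
    (convex_convexHull ℝ _).translate_preimage_left w
  refine convexHull_min ?_ hconv hx
  rintro y ⟨ω, hω, hy⟩
  exact subset_convexHull ℝ _ ⟨ω, hω, fun i => (hy i).trans (le_add_of_nonneg_right (hw i))⟩

theorem nonneg_of_isProperFace_functional {α : σ → ℝ} {c : ℝ}
    (hc : ∀ x ∈ newtonPolyhedron f, c ≤ α ⬝ᵥ x) {x : σ → ℝ} (hx : x ∈ newtonPolyhedron f)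
    (hxc : α ⬝ᵥ x = c) (i : σ) : 0 ≤ α i := by
  classical
  have h := hc _ (add_mem_newtonPolyhedron hx (Pi.single_nonneg.2 zero_le_one : 0 ≤ Pi.single i (1 : ℝ)))
  rw [dotProduct_add, hxc, dotProduct_single_one] at h
  linarith

theorem le_of_isFacetNormal {P : Set (σ → ℝ)} {a : σ → ℕ}
    (h : IsFacetNormal (newtonPolyhedron f) P a) {x y : σ → ℝ} (hx : x ∈ P)
    (hy : y ∈ newtonPolyhedron f) : realVec a ⬝ᵥ x ≤ realVec a ⬝ᵥ y := by
  obtain ⟨⟨⟨α, c, hα, hc, rfl, -⟩, hdim⟩, -, -, hperp⟩ := h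
  set P := {x ∈ newtonPolyhedron f | α ⬝ᵥ x = c}
  have hαne : dotLin α ≠ 0 := by
    intro h0
    refine hα (dotProduct_self_eq_zero.1 ?_)
    rw [← dotLin_apply, h0]
    rfl
  have hW1 : vectorSpan ℝ P ≤ LinearMap.ker (dotLin α) := by
    refine Submodule.span_le.2 ?_
    rintro _ ⟨x, hx, y, hy, rfl⟩
    change α ⬝ᵥ (x - y) = 0
    rw [dotProduct_sub, hx.2, hy.2, sub_self]
  have hW2 : vectorSpan ℝ P ≤ LinearMap.ker (dotLin (realVec a)) := by
    refine Submodule.span_le.2 ?_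
    rintro _ ⟨x, hx, y, hy, rfl⟩
    exact hperp x hx y hy
  have hker : vectorSpan ℝ P = LinearMap.ker (dotLin α) := by
    refine Submodule.eq_of_le_of_finrank_eq hW1 ?_
    have := Module.Dual.finrank_ker_add_one_of_ne_zero (f := dotLin α) hαne
    rw [Module.finrank_fintype_fun_eq_card] at this
    omega
  have hαα : 0 < α ⬝ᵥ α := by
    have h1 : 0 ≤ α ⬝ᵥ α := Finset.sum_nonneg fun i _ => mul_self_nonneg (α i)
    exact lt_of_le_of_ne h1 fun h => hα (dotProduct_self_eq_zero.1 h.symm)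
  have hαpos := nonneg_of_isProperFace_functional hc hx.1 hx.2
  have h1 : realVec a ⬝ᵥ (y - x) * (α ⬝ᵥ α) = (realVec a ⬝ᵥ α) * (α ⬝ᵥ (y - x)) := by
    have hmem : (α ⬝ᵥ α) • (y - x) - (α ⬝ᵥ (y - x)) • α ∈ LinearMap.ker (dotLin (realVec a)) := by
      refine hW2 (hker ▸ ?_)
      rw [LinearMap.mem_ker, map_sub, map_smul, map_smul, dotLin_apply, dotLin_apply, smul_eq_mul,
        smul_eq_mul]
      ring
    rw [LinearMap.mem_ker, map_sub, map_smul, map_smul, dotLin_apply, dotLin_apply, smul_eq_mul,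
        smul_eq_mul] at hmem
    linarith
  have h2 : 0 ≤ realVec a ⬝ᵥ α := Finset.sum_nonneg fun i _ =>
    mul_nonneg (Nat.cast_nonneg _) (hαpos i)
  have h3 : 0 ≤ α ⬝ᵥ (y - x) := by
    rw [dotProduct_sub, hx.2]
    linarith [hc y hy]
  have h4 : 0 ≤ realVec a ⬝ᵥ (y - x) := nonneg_of_mul_nonneg_left (h1 ▸ mul_nonneg h2 h3) hαα
  rw [dotProduct_sub] at h4
  linarith

theorem ne_zero_of_mem_newtonPolyhedron {x : σ → ℝ} (hx : x ∈ newtonPolyhedron f) : f ≠ 0 := by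
  rintro rfl
  simp [newtonPolyhedron] at hx

theorem newtonMin_eq_of_forall_le (a : σ → ℕ) {x : σ → ℝ} (hx : x ∈ newtonPolyhedron f)
    (hmin : ∀ y ∈ newtonPolyhedron f, realVec a ⬝ᵥ x ≤ realVec a ⬝ᵥ y) :
    (newtonMin f a : ℝ) = realVec a ⬝ᵥ x := by
  rw [natCast_newtonMin f (ne_zero_of_mem_newtonPolyhedron hx)]
  refine IsLeast.csInf_eq ⟨⟨x, hx, rfl⟩, ?_⟩
  rintro _ ⟨y, hy, rfl⟩
  exact hmin y hy

theorem realVec_mem_newtonPolyhedron {ω : σ →₀ ℕ} (hω : ω ∈ f.support) :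
    realVec ω ∈ newtonPolyhedron f :=
  subset_convexHull ℝ _ ⟨ω, hω, fun _ => le_rfl⟩

/-- `a · ω` for integral vectors. -/
def degNat (a : σ → ℕ) (ω : σ →₀ ℕ) : ℕ := ∑ l, a l * ω l

theorem realVec_dotProduct_realVec (a : σ → ℕ) (ω : σ →₀ ℕ) :
    realVec a ⬝ᵥ realVec ω = (degNat a ω : ℝ) := by
  simp [dotProduct, realVec, degNat]

/-- What the proof uses of normal vectors of facets that contain a common face. -/
structure IsNormalFamily {α : Type*} (f : MvPolynomial σ R) (τ : Set (σ → ℝ)) (a : α → σ → ℕ) :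
    Prop where
  nonempty : τ.Nonempty
  subset : τ ⊆ newtonPolyhedron f
  ne_zero : ∀ i, a i ≠ 0
  le : ∀ i, ∀ x ∈ newtonPolyhedron f, (newtonMin f (a i) : ℝ) ≤ realVec (a i) ⬝ᵥ x
  eq : ∀ i, ∀ x ∈ τ, realVec (a i) ⬝ᵥ x = newtonMin f (a i)

theorem isNormalFamily_of_facetNormals {α : Type*} {τ : Set (σ → ℝ)} {a : α → σ → ℕ}
    (hτ : IsProperFace (newtonPolyhedron f) τ)
    (ha : ∀ i, a i ∈ facetNormals (newtonPolyhedron f) τ) : IsNormalFamily f τ a := by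
  obtain ⟨_, _, -, -, hτeq, hne⟩ := hτ
  have hsub : τ ⊆ newtonPolyhedron f := fun x hx => by
    rw [hτeq] at hx
    exact hx.1
  have heq (i) (x) (hx : x ∈ τ) : (newtonMin f (a i) : ℝ) = realVec (a i) ⬝ᵥ x := by
    obtain ⟨P, hP, hτP⟩ := ha i
    exact newtonMin_eq_of_forall_le _ (hsub hx) fun y hy => le_of_isFacetNormal hP (hτP hx) hy
  refine ⟨hne, hsub, fun i => ?_, fun i x hx => ?_, fun i x hx => (heq i x hx).symm⟩
  · obtain ⟨P, hP, -⟩ := ha i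
    exact hP.2.1
  · obtain ⟨P, hP, hτP⟩ := ha i
    obtain ⟨y, hy⟩ := hne
    rw [heq i y hy]
    exact le_of_isFacetNormal hP (hτP hy) hx

variable {α : Type*} {τ : Set (σ → ℝ)} {a : α → σ → ℕ}

theorem IsNormalFamily.newtonMin_le_degNat (h : IsNormalFamily f τ a) (i : α) {ω : σ →₀ ℕ}
    (hω : ω ∈ f.support) : newtonMin f (a i) ≤ degNat (a i) ω := by
  have := h.le i _ (realVec_mem_newtonPolyhedron hω)
  rw [realVec_dotProduct_realVec] at this
  exact_mod_cast this

/-- The intersection of the facets with normal vectors `a i`, `i ∈ S`. -/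
def interFace (f : MvPolynomial σ R) (a : α → σ → ℕ) (S : Set α) : Set (σ → ℝ) :=
  {x ∈ newtonPolyhedron f | ∀ i ∈ S, realVec (a i) ⬝ᵥ x = newtonMin f (a i)}

theorem realVec_mem_interFace {S : Set α} {ω : σ →₀ ℕ} (hω : ω ∈ f.support) :
    realVec ω ∈ interFace f a S ↔ ∀ i ∈ S, degNat (a i) ω = newtonMin f (a i) := by
  simp only [interFace, Set.mem_ofPred_eq, realVec_mem_newtonPolyhedron hω, true_and,
    realVec_dotProduct_realVec, Nat.cast_inj]

theorem IsNormalFamily.isFace_interFace [Finite α] (h : IsNormalFamily f τ a) (S : Set α) :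
    IsFace (newtonPolyhedron f) (interFace f a S) := by
  classical
  have := Fintype.ofFinite α
  rcases S.eq_empty_or_nonempty with rfl | ⟨i0, hi0⟩
  · left
    simp [interFace]
  right
  have hdot (x : σ → ℝ) : (∑ i ∈ S.toFinset, realVec (a i)) ⬝ᵥ x =
      ∑ i ∈ S.toFinset, realVec (a i) ⬝ᵥ x := by
    rw [sum_dotProduct]
  refine ⟨∑ i ∈ S.toFinset, realVec (a i), ∑ i ∈ S.toFinset, (newtonMin f (a i) : ℝ), ?_, ?_, ?_, ?_⟩
  · intro h0
    refine h.ne_zero i0 (funext fun l => ?_)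
    have h1 := congrFun h0 l
    rw [Finset.sum_apply, Pi.zero_apply] at h1
    have h2 := (Finset.sum_eq_zero_iff_of_nonneg fun i _ =>
      (Nat.cast_nonneg (a i l) : 0 ≤ realVec (a i) l)).1 h1 i0 (by simpa using hi0)
    exact_mod_cast h2
  · intro x hx
    rw [hdot]
    exact Finset.sum_le_sum fun i _ => h.le i x hx
  · ext x
    simp only [interFace, Set.mem_ofPred_eq, hdot]
    refine and_congr_right fun hx => ?_
    rw [eq_comm, Finset.sum_eq_sum_iff_of_le fun i _ => h.le i x hx]
    simp [eq_comm]
  · obtain ⟨x, hx⟩ := h.nonempty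
    exact ⟨x, h.subset hx, fun i _ => h.eq i x hx⟩

end Polyhedron

section Family

variable {σ α : Type*} [Fintype σ] [Fintype α] {R : Type*} [CommRing R]

/-- The polynomial `∑ c_ω ∏ t_i ^ (a_i · ω - m_f(a_i)) x ^ ω`. -/
def degen (f : MvPolynomial σ R) (a : α → σ → ℕ) (t : α → R) : MvPolynomial σ R :=
  ∑ ω ∈ f.support, MvPolynomial.monomial ω
    (f.coeff ω * ∏ i, t i ^ (degNat (a i) ω - newtonMin f (a i)))

theorem eval_degen (f : MvPolynomial σ R) (a : α → σ → ℕ) (t : α → R) (z : σ → R) :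
    MvPolynomial.eval z (degen f a t) = ∑ ω ∈ f.support,
      (f.coeff ω * ∏ i, t i ^ (degNat (a i) ω - newtonMin f (a i))) * ∏ l, z l ^ ω l := by
  simp only [degen, map_sum, MvPolynomial.eval_monomial]
  refine Finset.sum_congr rfl fun ω _ => ?_
  rw [Finsupp.prod_fintype _ _ fun _ => pow_zero _]

theorem mul_eval_pderiv_degen (f : MvPolynomial σ R) (a : α → σ → ℕ) (t : α → R) (z : σ → R)
    (l : σ) :
    z l * MvPolynomial.eval z (MvPolynomial.pderiv l (degen f a t)) = ∑ ω ∈ f.support,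
      ω l * ((f.coeff ω * ∏ i, t i ^ (degNat (a i) ω - newtonMin f (a i))) * ∏ l, z l ^ ω l) := by
  have : z l * MvPolynomial.eval z (MvPolynomial.pderiv l (degen f a t)) =
      MvPolynomial.eval z (MvPolynomial.X l * MvPolynomial.pderiv l (degen f a t)) := by simp
  rw [this]
  simp only [degen, map_sum, Finset.mul_sum, MvPolynomial.X_mul_pderiv_monomial]
  refine Finset.sum_congr rfl fun ω _ => ?_
  rw [map_nsmul, MvPolynomial.eval_monomial, nsmul_eq_mul, Finsupp.prod_fintype _ _ fun _ => pow_zero _]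

theorem mul_aeval_pderiv_facePoly {K : Type*} [Field K] [Algebra R K] (f : MvPolynomial σ R)
    (τ : Set (σ → ℝ)) (x : σ → K) (l : σ) [DecidablePred fun ω : σ →₀ ℕ => realVec ω ∈ τ] :
    x l * MvPolynomial.aeval x (MvPolynomial.pderiv l (facePoly f τ)) =
      ∑ ω ∈ f.support, if realVec ω ∈ τ then
        ω l * (algebraMap R K (f.coeff ω) * ∏ l, x l ^ ω l) else 0 := by
  have : x l * MvPolynomial.aeval x (MvPolynomial.pderiv l (facePoly f τ)) =
      MvPolynomial.aeval x (MvPolynomial.X l * MvPolynomial.pderiv l (facePoly f τ)) := by simp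
  rw [this, ← Finset.sum_filter]
  simp only [facePoly, map_sum, Finset.mul_sum, MvPolynomial.X_mul_pderiv_monomial]
  refine Finset.sum_congr (by congr) fun ω _ => ?_
  rw [map_nsmul, MvPolynomial.aeval_monomial, nsmul_eq_mul, Finsupp.prod_fintype _ _ fun _ => pow_zero _]

theorem dvd_eval_degen_sub (f : MvPolynomial σ R) (a : α → σ → ℕ) {c : R} {t t' : α → R}
    (h : ∀ i, c ∣ t i - t' i) (z : σ → R) :
    c ∣ MvPolynomial.eval z (degen f a t) - MvPolynomial.eval z (degen f a t') := by
  rw [← Ideal.mem_span_singleton, ← Ideal.Quotient.eq, eval_degen, eval_degen]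
  have h' (i) : Ideal.Quotient.mk (Ideal.span {c}) (t i) = Ideal.Quotient.mk _ (t' i) := by
    rw [Ideal.Quotient.eq, Ideal.mem_span_singleton]
    exact h i
  simp only [map_sum, map_mul, map_prod, map_pow, h']

theorem continuous_eval_pderiv_degen [TopologicalSpace R] [IsTopologicalRing R]
    (f : MvPolynomial σ R) (a : α → σ → ℕ) (l : σ) :
    Continuous fun p : (α → R) × (σ → R) =>
      MvPolynomial.eval p.2 (MvPolynomial.pderiv l (degen f a p.1)) := by
  simp only [degen, map_sum, MvPolynomial.pderiv_monomial, MvPolynomial.eval_monomial]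
  refine continuous_finsetSum _ fun ω _ => ?_
  simp only [Finsupp.prod_fintype _ _ fun _ => pow_zero _]
  fun_prop

end Family

section Uniform

variable {σ α : Type*} [Fintype σ] [Fintype α] {O : Type*} [CommRing O] [IsDomain O]
  [IsDiscreteValuationRing O] {ϖ : O} {f : MvPolynomial σ O} {τ : Set (σ → ℝ)} {a : α → σ → ℕ}

theorem prod_pow_sum_mul (κ : α → ℕ) (a : α → σ → ℕ) (ϖ : O) (z : σ → O) (ω : σ →₀ ℕ) :
    ∏ l, (ϖ ^ (∑ i, κ i * a i l) * z l) ^ ω l =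
      ϖ ^ (∑ i, κ i * degNat (a i) ω) * ∏ l, z l ^ ω l := by
  simp only [mul_pow, Finset.prod_mul_distrib, ← pow_mul, Finset.prod_pow_eq_pow_sum]
  congr 2
  simp only [degNat, Finset.mul_sum, Finset.sum_mul]
  rw [Finset.sum_comm]
  exact Finset.sum_congr rfl fun i _ => Finset.sum_congr rfl fun l _ => by ring

theorem IsNormalFamily.eval_scale (h : IsNormalFamily f τ a) (κ : α → ℕ) (z : σ → O) :
    MvPolynomial.eval (scale ϖ (fun l => ∑ i, κ i * a i l) z) f =
      ϖ ^ (∑ i, κ i * newtonMin f (a i)) *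
        MvPolynomial.eval z (degen f a fun i => ϖ ^ κ i) := by
  rw [eval_degen, MvPolynomial.eval_eq', Finset.mul_sum]
  refine Finset.sum_congr rfl fun ω hω => ?_
  simp only [scale_apply]
  rw [prod_pow_sum_mul]
  have : ϖ ^ (∑ i, κ i * degNat (a i) ω) = ϖ ^ (∑ i, κ i * newtonMin f (a i)) *
      ∏ i, (ϖ ^ κ i) ^ (degNat (a i) ω - newtonMin f (a i)) := by
    simp only [← pow_mul, Finset.prod_pow_eq_pow_sum]
    rw [← pow_add, ← Finset.sum_add_distrib]
    congr 1
    refine Finset.sum_congr rfl fun i _ => ?_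
    rw [← mul_add, Nat.add_sub_cancel' (h.newtonMin_le_degNat i hω)]
  rw [this]
  ring

/-- The limits of the polynomials `ϖ ^ (-m) f (ϖ ^ κ x)` are non-critical on the unit points. -/
theorem IsNormalFamily.exists_eval_pderiv_degen_ne_zero {K : Type*} [Field K] [Algebra O K]
    [FaithfulSMul O K] (hϖ : Irreducible ϖ) (h : IsNormalFamily f τ a)
    (hf : NewtonNonCritical K f) {t : α → O} (ht : ∀ i, t i = 0 ∨ ∃ k : ℕ, t i = ϖ ^ k)
    {z : σ → O} (hz : z ∈ unitPts O σ) :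
    ∃ l, MvPolynomial.eval z (MvPolynomial.pderiv l (degen f a t)) ≠ 0 := by
  classical
  by_contra! hcrit
  have hinj := FaithfulSMul.algebraMap_injective O K
  have hk (i) : ∃ k : ℕ, (t i = 0 ∧ k = 0) ∨ t i = ϖ ^ k := by
    rcases ht i with h0 | ⟨k, h1⟩
    · exact ⟨0, Or.inl ⟨h0, rfl⟩⟩
    · exact ⟨k, Or.inr h1⟩
  choose κ hκ using hk
  let S : Set α := {i | t i = 0}
  let w : σ → O := scale ϖ (fun l => ∑ i, κ i * a i l) z
  refine hf _ (h.isFace_interFace S) ⟨fun l => algebraMap O K (w l), fun l => ?_, fun l => ?_⟩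
  · rw [Ne, map_eq_zero_iff _ hinj]
    exact mul_ne_zero (pow_ne_zero _ hϖ.ne_zero) (hz l).ne_zero
  have hw : algebraMap O K (w l) ≠ 0 := by
    rw [Ne, map_eq_zero_iff _ hinj]
    exact mul_ne_zero (pow_ne_zero _ hϖ.ne_zero) (hz l).ne_zero
  refine (mul_eq_zero_iff_left hw).1 ?_
  refine (mul_aeval_pderiv_facePoly f (interFace f a S) (fun l => algebraMap O K (w l)) l).trans ?_
  have hsum := mul_eval_pderiv_degen f a t z l
  rw [hcrit l, mul_zero] at hsum
  have key : ∀ ω ∈ f.support, (if realVec ω ∈ interFace f a S then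
      (ω l : O) * (f.coeff ω * ∏ l, w l ^ ω l) else 0) =
      ϖ ^ (∑ i, κ i * newtonMin f (a i)) *
        (ω l * ((f.coeff ω * ∏ i, t i ^ (degNat (a i) ω - newtonMin f (a i))) *
          ∏ l, z l ^ ω l)) := by
    intro ω hω
    rw [realVec_mem_interFace hω]
    split_ifs with hS
    · simp only [w, scale_apply]
      rw [prod_pow_sum_mul]
      have : ϖ ^ (∑ i, κ i * degNat (a i) ω) = ϖ ^ (∑ i, κ i * newtonMin f (a i)) *
          ∏ i, t i ^ (degNat (a i) ω - newtonMin f (a i)) := by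
        rw [← Finset.prod_pow_eq_pow_sum, ← Finset.prod_pow_eq_pow_sum, ← Finset.prod_mul_distrib]
        refine Finset.prod_congr rfl fun i _ => ?_
        rcases hκ i with ⟨h0, h1⟩ | h1
        · rw [hS i h0, h1]
          simp
        · rw [h1, ← pow_mul, ← pow_add, ← mul_add,
            Nat.add_sub_cancel' (h.newtonMin_le_degNat i hω)]
      rw [this]
      ring
    · push Not at hS
      obtain ⟨i, hi, hne⟩ := hS
      have : degNat (a i) ω - newtonMin f (a i) ≠ 0 := by
        have := h.newtonMin_le_degNat i hω
        omega
      rw [Finset.prod_eq_zero (Finset.mem_univ i) (by rw [show t i = 0 from hi, zero_pow this])]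
      ring
  have h2 := congrArg (algebraMap O K) (Finset.sum_congr rfl key)
  rw [← Finset.mul_sum, ← hsum, mul_zero, map_zero, map_sum] at h2
  refine Eq.trans (Finset.sum_congr rfl fun ω _ => ?_) h2
  rw [apply_ite (algebraMap O K), map_zero, map_mul, map_mul, map_natCast, map_prod]
  simp only [map_pow]

variable [TopologicalSpace O] [IsTopologicalRing O] [CompactSpace O] [T2Space O]

theorem isClosed_zero_or_pow (hϖ : Irreducible ϖ) :
    IsClosed {x : O | x = 0 ∨ ∃ k : ℕ, x = ϖ ^ k} := by
  have : {x : O | x = 0 ∨ ∃ k : ℕ, x = ϖ ^ k} =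
      ⋂ n : ℕ, ({x | ϖ ^ n ∣ x} ∪ ((fun k => ϖ ^ k) '' Set.Iio n)) := by
    ext x
    simp only [Set.mem_ofPred_eq, Set.mem_iInter, Set.mem_union, Set.mem_image, Set.mem_Iio]
    constructor
    · rintro (rfl | ⟨k, rfl⟩) n
      · simp
      · rcases le_or_gt n k with hnk | hnk
        · exact Or.inl (pow_dvd_pow _ hnk)
        · exact Or.inr ⟨k, hnk, rfl⟩
    · intro hx
      by_cases h0 : x = 0
      · exact Or.inl h0
      · obtain ⟨n, u, hu⟩ := IsDiscreteValuationRing.eq_unit_mul_pow_irreducible h0 hϖ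
        rcases hx (n + 1) with h1 | ⟨k, -, hk⟩
        · exfalso
          rw [hu, Units.dvd_mul_left] at h1
          exact absurd ((pow_dvd_pow_iff hϖ.ne_zero hϖ.not_isUnit).1 h1) (by omega)
        · exact Or.inr ⟨k, hk.symm⟩
  rw [this]
  exact isClosed_iInter fun n => (isClosed_setOf_pow_dvd n).union
    ((Set.finite_Iio n).image _).isClosed

/-- On a compact set, a nowhere vanishing family of continuous functions has bounded valuation. -/
theorem exists_pow_not_dvd_of_isCompact (hϖ : Irreducible ϖ) {X ι : Type*} [TopologicalSpace X]
    {S : Set X} (hS : IsCompact S) {F : ι → X → O} (hF : ∀ l, Continuous (F l))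
    (hne : ∀ x ∈ S, ∃ l, F l x ≠ 0) : ∃ e : ℕ, ∀ x ∈ S, ∃ l, ¬ ϖ ^ (e + 1) ∣ F l x := by
  refine hS.elim_directed_cover (fun e => {x | ∃ l, ¬ ϖ ^ (e + 1) ∣ F l x}) ?_ ?_ ?_
  · intro e
    have : {x | ∃ l, ¬ ϖ ^ (e + 1) ∣ F l x} = ⋃ l, {x | ϖ ^ (e + 1) ∣ F l x}ᶜ := by
      ext; simp
    rw [this]
    exact isOpen_iUnion fun l => ((isClosed_setOf_pow_dvd (e + 1)).preimage (hF l)).isOpen_compl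
  · intro x hx
    obtain ⟨l, hl⟩ := hne x hx
    obtain ⟨n, u, hu⟩ := IsDiscreteValuationRing.eq_unit_mul_pow_irreducible hl hϖ
    refine Set.mem_iUnion.2 ⟨n, l, fun h1 => ?_⟩
    rw [hu, Units.dvd_mul_left] at h1
    exact absurd ((pow_dvd_pow_iff hϖ.ne_zero hϖ.not_isUnit).1 h1) (by omega)
  · refine Monotone.directed_le fun e e' hee p hp => ?_
    obtain ⟨l, hl⟩ := hp
    exact ⟨l, fun hd => hl ((pow_dvd_pow _ (by omega)).trans hd)⟩

/-- The gradients of the polynomials `ϖ ^ (-m) f (ϖ ^ κ x)` have bounded valuation on the unit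
points, uniformly in `κ`. -/
theorem IsNormalFamily.exists_uniform {K : Type*} [Field K] [Algebra O K]
    [FaithfulSMul O K] (hϖ : Irreducible ϖ) (h : IsNormalFamily f τ a)
    (hf : NewtonNonCritical K f) :
    ∃ e : ℕ, ∀ κ : α → ℕ, ∀ z ∈ unitPts O σ, ∃ l,
      ¬ ϖ ^ (e + 1) ∣ MvPolynomial.eval z (MvPolynomial.pderiv l (degen f a fun i => ϖ ^ κ i)) := by
  have hT : IsCompact {t : α → O | ∀ i, t i = 0 ∨ ∃ k : ℕ, t i = ϖ ^ k} := by
    have : {t : α → O | ∀ i, t i = 0 ∨ ∃ k : ℕ, t i = ϖ ^ k} =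
        ⋂ i, {t | t i ∈ {x : O | x = 0 ∨ ∃ k : ℕ, x = ϖ ^ k}} := by
      ext; simp
    rw [this]
    exact (isClosed_iInter fun i => (isClosed_zero_or_pow hϖ).preimage
      (continuous_apply i)).isCompact
  obtain ⟨e, he⟩ := exists_pow_not_dvd_of_isCompact hϖ
    (hT.prod (isCompact_unitPts (ι := σ) hϖ)) (continuous_eval_pderiv_degen f a)
    fun p hp => h.exists_eval_pderiv_degen_ne_zero hϖ hf hp.1 hp.2
  exact ⟨e, fun κ z hz => he (fun i => ϖ ^ κ i, z) ⟨fun i => Or.inr ⟨κ i, rfl⟩, hz⟩⟩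

end Uniform

section Combined

variable {σ ρ α β : Type*} [Fintype σ] [Fintype ρ] [Fintype α] [Fintype β]
  {O : Type*} [CommRing O] [IsDomain O] [IsDiscreteValuationRing O]

/-- The numbers `m_f(a_i)`, extended by zero. -/
def minLeft (β : Type*) (f : MvPolynomial σ O) (a : α → σ → ℕ) : α ⊕ β → ℕ :=
  Sum.elim (fun i => newtonMin f (a i)) 0

/-- The numbers `m_g(b_j)`, extended by zero. -/
def minRight (α : Type*) (g : MvPolynomial ρ O) (b : β → ρ → ℕ) : α ⊕ β → ℕ :=
  Sum.elim 0 fun j => newtonMin g (b j)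

/-- The vector `(∑ κ_i a_i, ∑ κ_j b_j)`. -/
def coneVec (a : α → σ → ℕ) (b : β → ρ → ℕ) (κ : α ⊕ β →₀ ℕ) : σ ⊕ ρ → ℕ :=
  Sum.elim (fun l => ∑ i, κ (Sum.inl i) * a i l) fun l => ∑ j, κ (Sum.inr j) * b j l

/-- The polynomial `(f ⊕ g)(ϖ ^ κ z)` divided by its content. -/
def rescaled (ϖ : O) (f : MvPolynomial σ O) (g : MvPolynomial ρ O) (a : α → σ → ℕ)
    (b : β → ρ → ℕ) (κ : α ⊕ β →₀ ℕ) : MvPolynomial (σ ⊕ ρ) O :=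
  MvPolynomial.C (ϖ ^ (dotNat (minLeft β f a) κ -
      min (dotNat (minLeft β f a) κ) (dotNat (minRight α g b) κ))) *
    MvPolynomial.rename Sum.inl (degen f a fun i => ϖ ^ κ (Sum.inl i)) +
  MvPolynomial.C (ϖ ^ (dotNat (minRight α g b) κ -
      min (dotNat (minLeft β f a) κ) (dotNat (minRight α g b) κ))) *
    MvPolynomial.rename Sum.inr (degen g b fun j => ϖ ^ κ (Sum.inr j))

variable {ϖ : O} {f : MvPolynomial σ O} {g : MvPolynomial ρ O} {τ : Set (σ → ℝ)}
  {γ : Set (ρ → ℝ)} {a : α → σ → ℕ} {b : β → ρ → ℕ}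

theorem dotNat_minLeft (κ : α ⊕ β →₀ ℕ) :
    dotNat (minLeft β f a) κ = ∑ i, κ (Sum.inl i) * newtonMin f (a i) := by
  simp [dotNat, minLeft]

theorem dotNat_minRight (κ : α ⊕ β →₀ ℕ) :
    dotNat (minRight α g b) κ = ∑ j, κ (Sum.inr j) * newtonMin g (b j) := by
  simp [dotNat, minRight]

theorem minLeft_eq_zero_or_minRight_eq_zero (l : α ⊕ β) :
    minLeft β f a l = 0 ∨ minRight α g b l = 0 := by
  cases l <;> simp [minLeft, minRight]

theorem eval_rescaled (κ : α ⊕ β →₀ ℕ) (z : σ ⊕ ρ → O) :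
    MvPolynomial.eval z (rescaled ϖ f g a b κ) =
      ϖ ^ (dotNat (minLeft β f a) κ -
        min (dotNat (minLeft β f a) κ) (dotNat (minRight α g b) κ)) *
        MvPolynomial.eval (z ∘ Sum.inl) (degen f a fun i => ϖ ^ κ (Sum.inl i)) +
      ϖ ^ (dotNat (minRight α g b) κ -
        min (dotNat (minLeft β f a) κ) (dotNat (minRight α g b) κ)) *
        MvPolynomial.eval (z ∘ Sum.inr) (degen g b fun j => ϖ ^ κ (Sum.inr j)) := by
  simp only [rescaled, map_add, map_mul, MvPolynomial.eval_C, MvPolynomial.eval_rename]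

theorem eval_scale_polySum (hF : IsNormalFamily f τ a) (hG : IsNormalFamily g γ b)
    (κ : α ⊕ β →₀ ℕ) (z : σ ⊕ ρ → O) :
    MvPolynomial.eval (scale ϖ (coneVec a b κ) z) (polySum f g) =
      ϖ ^ min (dotNat (minLeft β f a) κ) (dotNat (minRight α g b) κ) *
        MvPolynomial.eval z (rescaled ϖ f g a b κ) := by
  rw [eval_rescaled, polySum, map_add, MvPolynomial.eval_rename, MvPolynomial.eval_rename, mul_add,
    ← mul_assoc, ← mul_assoc, ← pow_add, ← pow_add, Nat.add_sub_cancel' (min_le_left _ _),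
    Nat.add_sub_cancel' (min_le_right _ _), dotNat_minLeft, dotNat_minRight]
  congr 1
  · exact hF.eval_scale (fun i => κ (Sum.inl i)) (z ∘ Sum.inl)
  · exact hG.eval_scale (fun j => κ (Sum.inr j)) (z ∘ Sum.inr)

theorem pderiv_inr_rename_inl (p : MvPolynomial σ O) (l : ρ) :
    MvPolynomial.pderiv (Sum.inr l : σ ⊕ ρ) (MvPolynomial.rename Sum.inl p) = 0 := by
  classical
  refine MvPolynomial.pderiv_eq_zero_of_notMem_vars fun h => ?_
  have := MvPolynomial.vars_rename _ _ h
  simp at this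

theorem pderiv_inl_rename_inr (p : MvPolynomial ρ O) (l : σ) :
    MvPolynomial.pderiv (Sum.inl l : σ ⊕ ρ) (MvPolynomial.rename Sum.inr p) = 0 := by
  classical
  refine MvPolynomial.pderiv_eq_zero_of_notMem_vars fun h => ?_
  have := MvPolynomial.vars_rename _ _ h
  simp at this

theorem dvd_eval_rescaled_sub {M : ℕ} {κ κ' : α ⊕ β →₀ ℕ}
    (hκ : ∀ l, κ' l = κ l ∨ M ≤ κ' l ∧ M ≤ κ l)
    (hA : dotNat (minLeft β f a) κ' -
        min (dotNat (minLeft β f a) κ') (dotNat (minRight α g b) κ') =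
      dotNat (minLeft β f a) κ - min (dotNat (minLeft β f a) κ) (dotNat (minRight α g b) κ) ∨
      M ≤ dotNat (minLeft β f a) κ' -
        min (dotNat (minLeft β f a) κ') (dotNat (minRight α g b) κ') ∧
      M ≤ dotNat (minLeft β f a) κ - min (dotNat (minLeft β f a) κ) (dotNat (minRight α g b) κ))
    (hB : dotNat (minRight α g b) κ' -
        min (dotNat (minLeft β f a) κ') (dotNat (minRight α g b) κ') =
      dotNat (minRight α g b) κ - min (dotNat (minLeft β f a) κ) (dotNat (minRight α g b) κ) ∨
      M ≤ dotNat (minRight α g b) κ' -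
        min (dotNat (minLeft β f a) κ') (dotNat (minRight α g b) κ') ∧
      M ≤ dotNat (minRight α g b) κ - min (dotNat (minLeft β f a) κ) (dotNat (minRight α g b) κ))
    (z : σ ⊕ ρ → O) :
    ϖ ^ M ∣ MvPolynomial.eval z (rescaled ϖ f g a b κ') -
      MvPolynomial.eval z (rescaled ϖ f g a b κ) := by
  have hpow {x y : ℕ} (h : x = y ∨ M ≤ x ∧ M ≤ y) : ϖ ^ M ∣ ϖ ^ x - ϖ ^ y := by
    rcases h with rfl | ⟨h1, h2⟩
    · simp
    · exact dvd_sub (pow_dvd_pow _ h1) (pow_dvd_pow _ h2)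
  have hq {x y : O} : ϖ ^ M ∣ x - y ↔
      Ideal.Quotient.mk (Ideal.span {ϖ ^ M}) x = Ideal.Quotient.mk _ y := by
    rw [Ideal.Quotient.eq, Ideal.mem_span_singleton]
  have h1 := dvd_eval_degen_sub f a (fun i => hpow (hκ (Sum.inl i))) (z ∘ Sum.inl)
  have h2 := dvd_eval_degen_sub g b (fun j => hpow (hκ (Sum.inr j))) (z ∘ Sum.inr)
  have h3 := hpow hA
  have h4 := hpow hB
  rw [hq] at h1 h2 h3 h4 ⊢
  rw [eval_rescaled, eval_rescaled, map_add, map_add, map_mul, map_mul, map_mul, map_mul, h1, h2,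
    h3, h4]

theorem dvdSet_eq_of_dvd_sub {ι : Type*} {h h' : MvPolynomial ι O} {M L : ℕ} (hL : L ≤ M)
    (hd : ∀ z, ϖ ^ M ∣ MvPolynomial.eval z h - MvPolynomial.eval z h') :
    dvdSet h (ϖ ^ L) = dvdSet h' (ϖ ^ L) := by
  ext z
  exact dvd_iff_dvd_of_dvd_sub ((pow_dvd_pow _ hL).trans (hd z))

theorem isTruncInvariant_of_rescaled {A : Type*} [CommRing A] {Q : (α ⊕ β →₀ ℕ) → A} {M : ℕ}
    (hQ : ∀ κ κ' : α ⊕ β →₀ ℕ, (∀ z, ϖ ^ M ∣ MvPolynomial.eval z (rescaled ϖ f g a b κ') -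
      MvPolynomial.eval z (rescaled ϖ f g a b κ)) → Q κ' = Q κ) :
    IsTruncInvariant Q (minLeft β f a) (minRight α g b) M := by
  classical
  have hsingle (i : α ⊕ β) (κ : α ⊕ β →₀ ℕ) (hi : M ≤ κ i) (n : ℕ) (l : α ⊕ β) :
      (Finsupp.single i n + κ) l = κ l ∨ M ≤ (Finsupp.single i n + κ) l ∧ M ≤ κ l := by
    by_cases h : l = i
    · subst h
      right
      simp only [Finsupp.add_apply, Finsupp.single_eq_same]
      omega
    · left
      simp [Finsupp.single_eq_of_ne h]
  constructor
  · intro i j κ hi hj hκi hκj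
    have hc := dotNat_ray_left (i := i) (minLeft_eq_zero_or_minRight_eq_zero (f := f) (g := g)
      (a := a) (b := b)) hj
    have hd := dotNat_ray_right (j := j) (minLeft_eq_zero_or_minRight_eq_zero (f := f) (g := g)
      (a := a) (b := b)) hi
    refine hQ _ _ fun z => dvd_eval_rescaled_sub (fun l => ?_) ?_ ?_ z
    · by_cases h1 : l = i
      · subst h1
        exact Or.inr ⟨hκi.trans (Nat.le_add_left _ _), hκi⟩
      by_cases h2 : l = j
      · subst h2
        exact Or.inr ⟨hκj.trans (Nat.le_add_left _ _), hκj⟩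
      left
      simp [Finsupp.single_eq_of_ne h1, Finsupp.single_eq_of_ne h2]
    · left
      rw [dotNat_add _ _ κ, dotNat_add _ _ κ, hc, hd]
      omega
    · left
      rw [dotNat_add _ _ κ, dotNat_add _ _ κ, hc, hd]
      omega
  · intro i κ hi hi' hκ
    refine hQ _ _ fun z => dvd_eval_rescaled_sub (hsingle i κ hκ 1) (Or.inl ?_) (Or.inl ?_) z <;>
    rw [dotNat_add, dotNat_add, dotNat_single, dotNat_single, hi, hi', mul_zero, zero_add, zero_add]
  · intro i κ hi hκ hle
    have hi' := (minLeft_eq_zero_or_minRight_eq_zero (f := f) (g := g) (a := a)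
      (b := b) i).resolve_left hi.ne'
    refine hQ _ _ fun z => dvd_eval_rescaled_sub (hsingle i κ hκ 1) (Or.inr ?_) (Or.inl ?_) z <;>
    rw [dotNat_add, dotNat_add, dotNat_single, dotNat_single, hi'] <;> omega
  · intro i κ hi hκ hle
    have hi' := (minLeft_eq_zero_or_minRight_eq_zero (f := f) (g := g) (a := a)
      (b := b) i).resolve_right hi.ne'
    refine hQ _ _ fun z => dvd_eval_rescaled_sub (hsingle i κ hκ 1) (Or.inl ?_) (Or.inr ?_) z <;>
    rw [dotNat_add, dotNat_add, dotNat_single, dotNat_single, hi'] <;> omega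

theorem eq_of_sum_mul_eq (ha : LinearIndependent ℝ fun i => realVec (a i)) {k k' : α → ℕ}
    (h : ∀ l, ∑ i, k i * a i l = ∑ i, k' i * a i l) : k = k' := by
  have h1 : ∑ i, ((k i : ℝ) - k' i) • realVec (a i) = 0 := by
    ext l
    have h2 : ∑ i, (k i : ℝ) * a i l = ∑ i, (k' i : ℝ) * a i l := by exact_mod_cast h l
    simp only [Finset.sum_apply, Pi.smul_apply, smul_eq_mul, realVec, sub_mul,
      Finset.sum_sub_distrib, h2, sub_self, Pi.zero_apply]
  ext i
  have h3 := Fintype.linearIndependent_iff.1 ha _ h1 i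
  exact_mod_cast sub_eq_zero.1 h3

theorem coneVec_injective (ha : LinearIndependent ℝ fun i => realVec (a i))
    (hb : LinearIndependent ℝ fun j => realVec (b j)) : Function.Injective (coneVec a b) := by
  intro κ κ' h
  ext l
  rcases l with i | j
  · exact congrFun (eq_of_sum_mul_eq ha (k := fun i => κ (Sum.inl i))
      (k' := fun i => κ' (Sum.inl i)) fun l => congrFun h (Sum.inl l)) i
  · exact congrFun (eq_of_sum_mul_eq hb (k := fun j => κ (Sum.inr j))
      (k' := fun j => κ' (Sum.inr j)) fun l => congrFun h (Sum.inr l)) j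

theorem range_coneVec {u v : ℕ} (a : Fin u → σ → ℕ) (b : Fin v → ρ → ℕ) :
    Set.range (coneVec a b) = prodSet (natCone a) (natCone b) := by
  ext k
  constructor
  · rintro ⟨κ, rfl⟩
    refine ⟨⟨fun i => κ (Sum.inl i), ?_⟩, ⟨fun j => κ (Sum.inr j), ?_⟩⟩ <;>
    · ext l
      simp [coneVec]
  · rintro ⟨⟨x, hx⟩, ⟨y, hy⟩⟩
    refine ⟨Finsupp.equivFunOnFinite.symm (Sum.elim x y), ?_⟩
    ext l
    rcases l with l | l
    · have := congrFun hx l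
      simpa [coneVec] using this
    · have := congrFun hy l
      simpa [coneVec] using this

theorem sum_coneVec (κ : α ⊕ β →₀ ℕ) :
    ∑ l, coneVec a b κ l = ∑ i, κ (Sum.inl i) * wt (a i) + ∑ j, κ (Sum.inr j) * wt (b j) := by
  rw [Fintype.sum_sum_type]
  simp only [coneVec, Sum.elim_inl, Sum.elim_inr, wt, Finset.mul_sum]
  rw [Finset.sum_comm, Finset.sum_comm (f := fun l j => κ (Sum.inr j) * b j l)]

variable [TopologicalSpace O] [IsTopologicalRing O] [CompactSpace O] [T2Space O]

theorem exists_uniform_rescaled {K : Type*} [Field K] [Algebra O K] [FaithfulSMul O K]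
    (hϖ : Irreducible ϖ) (hF : IsNormalFamily f τ a) (hG : IsNormalFamily g γ b)
    (hf : NewtonNonCritical K f) (hg : NewtonNonCritical K g) :
    ∃ e : ℕ, ∀ κ : α ⊕ β →₀ ℕ, ∀ z ∈ unitPts O (σ ⊕ ρ), ∃ l,
      ¬ ϖ ^ (e + 1) ∣ MvPolynomial.eval z (MvPolynomial.pderiv l (rescaled ϖ f g a b κ)) := by
  obtain ⟨e, he⟩ := hF.exists_uniform hϖ hf
  obtain ⟨e', he'⟩ := hG.exists_uniform hϖ hg
  refine ⟨max e e', fun κ z hz => ?_⟩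
  rcases le_total (dotNat (minLeft β f a) κ) (dotNat (minRight α g b) κ) with hle | hle
  · obtain ⟨l, hl⟩ := he (fun i => κ (Sum.inl i)) (z ∘ Sum.inl) fun i => hz _
    refine ⟨Sum.inl l, fun hd => hl ((pow_dvd_pow _ (by omega)).trans (b := ϖ ^ (max e e' + 1)) ?_)⟩
    convert hd using 1
    rw [rescaled, map_add, MvPolynomial.pderiv_C_mul, MvPolynomial.pderiv_C_mul,
      MvPolynomial.pderiv_rename Sum.inl_injective, pderiv_inl_rename_inr, min_eq_left hle]
    simp [MvPolynomial.eval_rename]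
  · obtain ⟨l, hl⟩ := he' (fun j => κ (Sum.inr j)) (z ∘ Sum.inr) fun j => hz _
    refine ⟨Sum.inr l, fun hd => hl ((pow_dvd_pow _ (by omega)).trans (b := ϖ ^ (max e e' + 1)) ?_)⟩
    convert hd using 1
    rw [rescaled, map_add, MvPolynomial.pderiv_C_mul, MvPolynomial.pderiv_C_mul,
      MvPolynomial.pderiv_rename Sum.inr_injective, pderiv_inr_rename_inl, min_eq_right hle]
    simp [MvPolynomial.eval_rename]

end Combined

section LocalFactor

open Polynomial

variable {O : Type*} [CommRing O] [IsDomain O] [IsDiscreteValuationRing O] [TopologicalSpace O]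
  [IsTopologicalRing O] [CompactSpace O] [T2Space O] {ϖ : O} {ι : Type*} [Fintype ι]
  [MeasurableSpace (ι → O)] [BorelSpace (ι → O)] (μ : Measure (ι → O))

/-- The measure of `S` if it is rational. -/
def ratMeasure (S : Set (ι → O)) : ℚ :=
  open Classical in if h : ∃ r : ℚ, μ.real S = r then h.choose else 0

/-- The polynomial `(1 - q⁻¹ T) ∫ |h| ^ s` in `T = q ^ (-s)`, the integral over the unit points. -/
def localPoly (ϖ : O) (M : ℕ) (h : MvPolynomial ι O) : ℚ[X] :=
  (1 - C (resCard O : ℚ)⁻¹ * X) * ∑ L ∈ Finset.range M, X ^ L *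
      C (ratMeasure μ (unitPts O ι ∩ dvdSet h (ϖ ^ L)) -
        ratMeasure μ (unitPts O ι ∩ dvdSet h (ϖ ^ (L + 1)))) +
    X ^ M * C (1 - (resCard O : ℚ)⁻¹) * C (ratMeasure μ (unitPts O ι ∩ dvdSet h (ϖ ^ M)))

theorem localPoly_eq_of_dvd_sub {h h' : MvPolynomial ι O} {M : ℕ}
    (hd : ∀ z, ϖ ^ M ∣ MvPolynomial.eval z h - MvPolynomial.eval z h') :
    localPoly μ ϖ M h = localPoly μ ϖ M h' := by
  rw [localPoly, localPoly, dvdSet_eq_of_dvd_sub le_rfl hd]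
  congr 2
  refine Finset.sum_congr rfl fun L hL => ?_
  have := Finset.mem_range.1 hL
  rw [dvdSet_eq_of_dvd_sub this.le hd, dvdSet_eq_of_dvd_sub (Nat.succ_le_of_lt this) hd]

theorem aeval_localPoly [IsProbabilityMeasure μ] [μ.IsAddLeftInvariant]
    (hϖ : Irreducible ϖ)
    (h : MvPolynomial ι O) {s : ℂ} (hs : 0 < s.re) {e M : ℕ} (hM : 2 * e + 1 ≤ M)
    (hder : ∀ z ∈ unitPts O ι, ∃ i, ¬ ϖ ^ (e + 1) ∣ MvPolynomial.eval z (MvPolynomial.pderiv i h)) :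
    aeval ((resCard O : ℂ) ^ (-s)) (localPoly μ ϖ M h) =
      (1 - (resCard O : ℂ)⁻¹ * (resCard O : ℂ) ^ (-s)) *
        ∫ z in unitPts O ι, zetaIntegrand h s z ∂μ := by
  have hr (L) : ((ratMeasure μ (unitPts O ι ∩ dvdSet h (ϖ ^ L)) : ℚ) : ℂ) =
      (μ.real (unitPts O ι ∩ dvdSet h (ϖ ^ L)) : ℂ) := by
    have hex := exists_rat_measureReal_unitPts_inter_dvdSet μ hϖ h L
    rw [ratMeasure, dif_pos hex]
    exact_mod_cast congrArg (fun x : ℝ => (x : ℂ)) hex.choose_spec.symm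
  rw [setIntegral_unitPts_zetaIntegrand μ hϖ h hs hM hder, localPoly]
  simp [hr]

end LocalFactor

section Assembly

open Polynomial

variable {σ ρ α β : Type*} [Fintype σ] [Fintype ρ] [Fintype α] [Fintype β]
  {O : Type*} [CommRing O] [IsDomain O] [IsDiscreteValuationRing O]
  {ϖ : O} {f : MvPolynomial σ O} {g : MvPolynomial ρ O} {τ : Set (σ → ℝ)}
  {γ : Set (ρ → ℝ)} {a : α → σ → ℕ} {b : β → ρ → ℕ}

theorem absO_pow_mul_cpow (hϖ : Irreducible ϖ) (m : ℕ) (x : O) {s : ℂ} (hs : s ≠ 0) :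
    ((absO (ϖ ^ m * x) : ℝ) : ℂ) ^ s =
      ((resCard O : ℂ) ^ (-s)) ^ m * ((absO x : ℝ) : ℂ) ^ s := by
  by_cases hx : x = 0
  · simp [hx, absO_zero_cpow hs]
  · have h1 : IsDiscreteValuationRing.addVal O x ≠ ⊤ := by
      rwa [Ne, IsDiscreteValuationRing.addVal_eq_top_iff]
    obtain ⟨n, hn⟩ := ENat.ne_top_iff_exists.1 h1
    rw [absO_cpow hn.symm, absO_cpow (n := m + n), pow_add]
    rw [IsDiscreteValuationRing.addVal_mul, hϖ.addVal_pow, ← hn, Nat.cast_add]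

theorem zetaIntegrand_scale (hϖ : Irreducible ϖ) (hF : IsNormalFamily f τ a)
    (hG : IsNormalFamily g γ b) (κ : α ⊕ β →₀ ℕ) {s : ℂ} (hs : s ≠ 0) (z : σ ⊕ ρ → O) :
    zetaIntegrand (polySum f g) s (scale ϖ (coneVec a b κ) z) =
      ((resCard O : ℂ) ^ (-s)) ^ min (dotNat (minLeft β f a) κ) (dotNat (minRight α g b) κ) *
        zetaIntegrand (rescaled ϖ f g a b κ) s z := by
  rw [zetaIntegrand, eval_scale_polySum hF hG, absO_pow_mul_cpow hϖ _ _ hs, zetaIntegrand]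

/-- The value at `q ^ (-s)` of the monomial attached to the pair `(a, b)`. -/
theorem powBot_cExp (a : σ → ℕ) (b : ρ → ℕ) (s : ℂ) {q : ℕ} (hq : q ≠ 0)
    (h : 0 < newtonMin f a ∧ 0 < newtonMin g b) :
    powBot q (cExp f g a b s) = ((q : ℂ) ^ (-s)) ^ (newtonMin f a).lcm (newtonMin g b) *
      (((q : ℂ)⁻¹ ^ wt a) ^ (newtonMin g b / (newtonMin f a).gcd (newtonMin g b)) *
        ((q : ℂ)⁻¹ ^ wt b) ^ (newtonMin f a / (newtonMin f a).gcd (newtonMin g b))) := by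
  have hq' : (q : ℂ) ≠ 0 := Nat.cast_ne_zero.2 hq
  rw [cExp, if_pos h, powBot, WithBot.recBotCoe_coe, ← pow_mul, ← pow_mul, ← Complex.cpow_nat_mul,
    ← pow_add, inv_pow, ← Complex.cpow_natCast, ← Complex.cpow_neg, ← Complex.cpow_add _ _ hq']
  congr 1
  push_cast
  ring

theorem powBot_cExp_of_not (a : σ → ℕ) (b : ρ → ℕ) (s : ℂ) (q : ℕ)
    (h : ¬ (0 < newtonMin f a ∧ 0 < newtonMin g b)) : powBot q (cExp f g a b s) = 0 := by
  rw [cExp, if_neg h]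
  rfl

/-- The base point at which the series over the cone is evaluated. -/
def conePoint (q : ℕ) (a : α → σ → ℕ) (b : β → ρ → ℕ) : α ⊕ β → ℚ :=
  Sum.elim (fun i => (q : ℚ)⁻¹ ^ wt (a i)) fun j => (q : ℚ)⁻¹ ^ wt (b j)

theorem prod_conePoint_pow (q : ℕ) (κ : α ⊕ β →₀ ℕ) :
    ∏ l, (conePoint q a b l : ℂ) ^ κ l = ((q : ℂ)⁻¹) ^ (∑ l, coneVec a b κ l) := by
  rw [sum_coneVec, Fintype.prod_sum_type, pow_add]
  simp only [conePoint, Sum.elim_inl, Sum.elim_inr, Rat.cast_pow, Rat.cast_inv, Rat.cast_natCast,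
    ← pow_mul, Finset.prod_pow_eq_pow_sum, mul_comm (wt _)]

theorem prod_eval₂_rayFactor {q : ℕ} (hq : q ≠ 0) (s : ℂ) :
    ∏ i, ∏ j, MvPolynomial.eval₂ (aeval ((q : ℂ) ^ (-s)) : ℚ[X] →ₐ[ℚ] ℂ).toRingHom
        (fun l => (conePoint q a b l : ℂ)) (rayFactor X (minLeft β f a) (minRight α g b) i j) =
      ∏ i, ∏ j, (1 - powBot q (cExp f g (a i) (b j) s)) := by
  classical
  have hll (i i' : α) : rayFactor (X : ℚ[X]) (minLeft β f a) (minRight α g b) (Sum.inl i)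
      (Sum.inl i') = 1 := by simp [rayFactor, minRight]
  have hrl (j : β) (l) : rayFactor (X : ℚ[X]) (minLeft β f a) (minRight α g b) (Sum.inr j)
      l = 1 := by simp [rayFactor, minLeft]
  simp only [Fintype.prod_sum_type, hll, hrl, MvPolynomial.eval₂_one, Finset.prod_const_one,
    one_mul, mul_one]
  refine Finset.prod_congr rfl fun i _ => Finset.prod_congr rfl fun j _ => ?_
  by_cases h : 0 < newtonMin f (a i) ∧ 0 < newtonMin g (b j)
  · have h' : 0 < minLeft β f a (Sum.inl i) ∧ 0 < minRight α g b (Sum.inr j) := h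
    rw [powBot_cExp _ _ _ hq h, rayFactor, if_pos h', MvPolynomial.eval₂_sub,
      MvPolynomial.eval₂_one, MvPolynomial.eval₂_monomial, Finsupp.prod_fintype _ _
        fun _ => pow_zero _, Fintype.prod_sum_type]
    congr 2
    · simp [minLeft, minRight]
    congr 1
    · rw [Finset.prod_eq_single i (fun x _ hx => by simp [Finsupp.single_eq_of_ne, hx]) (by simp)]
      simp [conePoint, minLeft, minRight]
    · rw [Finset.prod_eq_single j (fun x _ hx => by simp [Finsupp.single_eq_of_ne, hx]) (by simp)]
      simp [conePoint, minLeft, minRight]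
  · have h' : ¬ (0 < minLeft β f a (Sum.inl i) ∧ 0 < minRight α g b (Sum.inr j)) := h
    rw [powBot_cExp_of_not _ _ _ _ h, rayFactor, if_neg h', MvPolynomial.eval₂_one, sub_zero]

theorem wt_pos {a : σ → ℕ} (ha : a ≠ 0) : 0 < wt a := by
  rw [Nat.pos_iff_ne_zero]
  exact fun h => ha (funext fun i => Finset.sum_eq_zero_iff.1 h i (Finset.mem_univ i))

theorem one_sub_conePoint_ne_zero {q : ℕ} (hq : 1 < q) (ha : ∀ i, a i ≠ 0) (hb : ∀ j, b j ≠ 0)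
    (l : α ⊕ β) : 1 - conePoint q a b l ≠ 0 := by
  have h1 : (q : ℚ)⁻¹ < 1 := inv_lt_one_of_one_lt₀ (by exact_mod_cast hq)
  have h0 : 0 ≤ (q : ℚ)⁻¹ := by positivity
  rcases l with i | j
  · exact (sub_pos.2 (pow_lt_one₀ h0 h1 (wt_pos (ha i)).ne')).ne'
  · exact (sub_pos.2 (pow_lt_one₀ h0 h1 (wt_pos (hb j)).ne')).ne'

variable [TopologicalSpace O] [IsTopologicalRing O] [CompactSpace O] [T2Space O]
  [MeasurableSpace (σ ⊕ ρ → O)] [BorelSpace (σ ⊕ ρ → O)] (μ : Measure (σ ⊕ ρ → O))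
  [μ.IsAddHaarMeasure] [IsProbabilityMeasure μ]

theorem one_sub_powBot_ne_zero (a : σ → ℕ) (b : ρ → ℕ) {s : ℂ} (hs : 0 < s.re) :
    1 - powBot (resCard O) (cExp f g a b s) ≠ 0 := by
  by_cases h : 0 < newtonMin f a ∧ 0 < newtonMin g b
  · have hq := one_lt_resCard (O := O)
    have hT := norm_resCard_cpow_neg_lt_one (O := O) hs
    rw [powBot_cExp _ _ _ (by omega) h, sub_ne_zero]
    intro h1
    have h2 := congrArg norm h1
    have hinv : ‖(resCard O : ℂ)⁻¹‖ ≤ 1 := by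
      rw [norm_inv, Complex.norm_natCast]
      exact inv_le_one_of_one_le₀ (by exact_mod_cast hq.le)
    have h3 : ‖((resCard O : ℂ) ^ (-s)) ^ (newtonMin f a).lcm (newtonMin g b)‖ < 1 := by
      rw [norm_pow]
      exact pow_lt_one₀ (norm_nonneg _) hT (Nat.lcm_pos h.1 h.2).ne'
    rw [norm_one, norm_mul, norm_mul, ← pow_mul, ← pow_mul, norm_pow (_ : ℂ)⁻¹,
      norm_pow (_ : ℂ)⁻¹] at h2
    have h4 := mul_le_one₀ (pow_le_one₀ (n := wt a * (newtonMin g b /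
      (newtonMin f a).gcd (newtonMin g b))) (norm_nonneg _) hinv) (by positivity)
      (pow_le_one₀ (n := wt b * (newtonMin f a /
      (newtonMin f a).gcd (newtonMin g b))) (norm_nonneg _) hinv)
    exact (mul_lt_one_of_nonneg_of_lt_one_left (norm_nonneg _) h3 h4).ne' h2
  · rw [powBot_cExp_of_not _ _ _ _ h, sub_zero]
    exact one_ne_zero

theorem hasSum_zeta (hϖ : Irreducible ϖ) (hF : IsNormalFamily f τ a) (hG : IsNormalFamily g γ b)
    (ha : LinearIndependent ℝ fun i => realVec (a i))
    (hb : LinearIndependent ℝ fun j => realVec (b j)) {s : ℂ} (hs : 0 < s.re) :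
    HasSum (fun κ : α ⊕ β →₀ ℕ => ((resCard O : ℂ)⁻¹) ^ (∑ l, coneVec a b κ l) *
        (((resCard O : ℂ) ^ (-s)) ^ min (dotNat (minLeft β f a) κ) (dotNat (minRight α g b) κ) *
          ∫ z in unitPts O (σ ⊕ ρ), zetaIntegrand (rescaled ϖ f g a b κ) s z ∂μ))
      (∫ x in shell (Set.range (coneVec a b)), zetaIntegrand (polySum f g) s x ∂μ) := by
  have hs0 : s ≠ 0 := by rintro rfl; simp at hs
  have hU : (shell (Set.range (coneVec a b)) : Set (σ ⊕ ρ → O)) =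
      ⋃ κ : α ⊕ β →₀ ℕ, shell {coneVec a b κ} := by
    ext x
    simp [shell]
  rw [hU]
  convert! hasSum_integral_iUnion (μ := μ) (f := zetaIntegrand (polySum f g) s)
    (s := fun κ : α ⊕ β →₀ ℕ => (shell {coneVec a b κ} : Set (σ ⊕ ρ → O)))
    (fun κ => measurableSet_shell_singleton _) ?_
    (integrable_zetaIntegrand μ (polySum f g) hs).integrableOn using 1
  · ext κ
    rw [setIntegral_shell_singleton μ hϖ, ← integral_const_mul]
    simp only [zetaIntegrand_scale hϖ hF hG κ hs0]
  · exact fun κ κ' hne => disjoint_shell fun h => hne (coneVec_injective ha hb h)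

theorem exists_polynomial_zeta {K : Type*} [Field K] [Algebra O K] [FaithfulSMul O K]
    (hF : IsNormalFamily f τ a) (hG : IsNormalFamily g γ b)
    (hf : NewtonNonCritical K f) (hg : NewtonNonCritical K g)
    (ha : LinearIndependent ℝ fun i => realVec (a i))
    (hb : LinearIndependent ℝ fun j => realVec (b j)) :
    ∃ P : ℚ[X], ∀ s : ℂ, 0 < s.re →
      ∫ x in shell (Set.range (coneVec a b)), zetaIntegrand (polySum f g) s x ∂μ =
        aeval ((resCard O : ℂ) ^ (-s)) P / ((1 - (resCard O : ℂ) ^ (-1 - s)) *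
          ∏ i, ∏ j, (1 - powBot (resCard O) (cExp f g (a i) (b j) s))) := by
  obtain ⟨ϖ, hϖ⟩ := IsDiscreteValuationRing.exists_irreducible O
  obtain ⟨e, he⟩ := exists_uniform_rescaled hϖ hF hG hf hg
  have hq1 := one_lt_resCard (O := O)
  have hq0 : (resCard O : ℂ) ≠ 0 := Nat.cast_ne_zero.2 (by omega)
  obtain ⟨P, hP⟩ := exists_polynomial_of_isTruncInvariant minLeft_eq_zero_or_minRight_eq_zero
    (isTruncInvariant_of_rescaled (M := 2 * e + 1)
      (Q := fun κ => localPoly μ ϖ (2 * e + 1) (rescaled ϖ f g a b κ))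
      fun κ κ' h => localPoly_eq_of_dvd_sub μ h) (conePoint (resCard O) a b)
  refine ⟨C (∏ l, (1 - conePoint (resCard O) a b l))⁻¹ * P, fun s hs => ?_⟩
  have h1 := (hasSum_zeta μ hϖ hF hG ha hb hs).mul_left
    (1 - (resCard O : ℂ)⁻¹ * (resCard O : ℂ) ^ (-s))
  set Z := ∫ x in shell (Set.range (coneVec a b)), zetaIntegrand (polySum f g) s x ∂μ
  have h2 := hP ((resCard O : ℂ) ^ (-s)) _ (by
    convert! h1 using 1
    ext κ
    rw [aeval_localPoly μ hϖ _ hs le_rfl (he κ), prod_conePoint_pow]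
    ring)
  rw [prod_eval₂_rayFactor (by omega)] at h2
  have h3 : (resCard O : ℂ) ^ (-1 - s) = (resCard O : ℂ)⁻¹ * (resCard O : ℂ) ^ (-s) := by
    rw [sub_eq_add_neg, Complex.cpow_add _ _ hq0, Complex.cpow_neg_one]
  have h4 : (∏ i, ∏ j, (1 - powBot (resCard O) (cExp f g (a i) (b j) s))) ≠ 0 :=
    Finset.prod_ne_zero_iff.2 fun i _ => Finset.prod_ne_zero_iff.2 fun j _ =>
      one_sub_powBot_ne_zero _ _ hs
  have h5 : 1 - (resCard O : ℂ)⁻¹ * (resCard O : ℂ) ^ (-s) ≠ 0 := by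
    intro h0
    have hlt : ‖(resCard O : ℂ)⁻¹ * (resCard O : ℂ) ^ (-s)‖ < 1 := by
      rw [norm_mul, norm_inv, Complex.norm_natCast]
      exact mul_lt_one_of_nonneg_of_lt_one_right
        (inv_le_one_of_one_le₀ (by exact_mod_cast hq1.le)) (norm_nonneg _)
        (norm_resCard_cpow_neg_lt_one hs)
    rw [← sub_eq_zero.1 h0] at hlt
    simp at hlt
  have h6 : (∏ l, (1 - (conePoint (resCard O) a b l : ℂ))) ≠ 0 :=
    Finset.prod_ne_zero_iff.2 fun l _ => by
      exact_mod_cast one_sub_conePoint_ne_zero hq1 hF.ne_zero hG.ne_zero l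
  rw [h3, eq_div_iff (mul_ne_zero h5 h4), map_mul, aeval_C, ← h2, eq_ratCast, Rat.cast_inv,
    Rat.cast_prod]
  push_cast
  field_simp

end Assembly

section HaarMeasure

variable {O : Type*} [CommRing O] [TopologicalSpace O] [IsTopologicalRing O] [CompactSpace O]
  (σ : Type*)

theorem isAddHaarMeasure_haarO :
    @Measure.IsAddHaarMeasure _ _ _ (borel (σ → O)) (haarO O σ) := by
  borelize (σ → O)
  exact Measure.isAddHaarMeasure_addHaarMeasure ⊤

theorem isProbabilityMeasure_haarO : @IsProbabilityMeasure _ (borel (σ → O)) (haarO O σ) := by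
  borelize (σ → O)
  exact ⟨Measure.addHaarMeasure_self (K₀ := (⊤ : TopologicalSpace.PositiveCompacts (σ → O)))⟩

end HaarMeasure

theorem t2Space_of_isNonarchimedeanLocalField (K : Type*) [Field K] [ValuativeRel K]
    [TopologicalSpace K] [IsNonarchimedeanLocalField K] : T2Space K := by
  let := IsTopologicalAddGroup.rightUniformSpace K
  have := isUniformAddGroup_of_addCommGroup (G := K)
  have : T0Space K := ValuedRing.separated (Γ₀ := ValuativeRel.ValueGroupWithZero K)
  infer_instance

end ThomSebastiani

end

open ThomSebastiani
theorem mainTheorem3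
    {K : Type*} [Field K] [CharZero K] [ValuativeRel K] [TopologicalSpace K]
    [IsNonarchimedeanLocalField K]
    {n m : ℕ} (f : MvPolynomial (Fin n) 𝒪[K]) (g : MvPolynomial (Fin m) 𝒪[K])
    (hf : NewtonNonCritical K f) (hg : NewtonNonCritical K g)
    (τ : Set (Fin n → ℝ)) (γ : Set (Fin m → ℝ))
    (hτ : IsProperFace (newtonPolyhedron f) τ) (hγ : IsProperFace (newtonPolyhedron g) γ)
    {u v : ℕ} (a : Fin u → Fin n → ℕ) (b : Fin v → Fin m → ℕ)
    (ha : ∀ i, a i ∈ facetNormals (newtonPolyhedron f) τ)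
    (hb : ∀ j, b j ∈ facetNormals (newtonPolyhedron g) γ)
    (ha_ind : LinearIndependent ℝ fun i => realVec (a i))
    (hb_ind : LinearIndependent ℝ fun j => realVec (b j)) :
    ∃ P : Polynomial ℚ, ∀ s : ℂ, 0 < s.re →
      IntegrableOn (zetaIntegrand (polySum f g) s)
        (shell (prodSet (natCone a) (natCone b))) (haarO 𝒪[K] (Fin n ⊕ Fin m)) ∧
      zetaOn (prodSet (natCone a) (natCone b)) (polySum f g) s =
        Polynomial.aeval ((resCard 𝒪[K] : ℂ) ^ (-s)) P /
          ((1 - (resCard 𝒪[K] : ℂ) ^ (-1 - s)) *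
            ∏ i, ∏ j, (1 - powBot (resCard 𝒪[K]) (cExp f g (a i) (b j) s))) := by
  have hF := isNormalFamily_of_facetNormals hτ ha
  have hG := isNormalFamily_of_facetNormals hγ hb
  let : MeasurableSpace (Fin n ⊕ Fin m → 𝒪[K]) := borel _
  have : BorelSpace (Fin n ⊕ Fin m → 𝒪[K]) := ⟨rfl⟩
  have : (haarO 𝒪[K] (Fin n ⊕ Fin m)).IsAddHaarMeasure := isAddHaarMeasure_haarO _
  have : IsProbabilityMeasure (haarO 𝒪[K] (Fin n ⊕ Fin m)) := isProbabilityMeasure_haarO _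
  have : T2Space K := t2Space_of_isNonarchimedeanLocalField K
  obtain ⟨P, hP⟩ := exists_polynomial_zeta (haarO 𝒪[K] (Fin n ⊕ Fin m)) hF hG hf hg ha_ind hb_ind
  refine ⟨P, fun s hs => ⟨(integrable_zetaIntegrand _ _ hs).integrableOn, ?_⟩⟩
  rw [zetaOn, ← range_coneVec]
  exact hP s hs
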